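/- **Conventions.** Fix $d\ge 1$, $s\in(0,1)$ and $0<\lambda<\Lambda$. Write $B_R(x)=\{y\in\mathbb R^d:|x-y|<R\}$, $B_R=B_R(0)$, $I_R=(-R^{2s},0]$, and $$d((x,t),(y,\tau))=\max\{|x-y|,|t-\tau|^{1/(2s)}\}.$$ For a function $w$ on $\mathbb R^d$ that is differentiable at $x$, put $\delta_yw(x)=w(x+y)-w(x)$ if $s<1/2$, $\delta_yw(x)=w(x+y)-w(x)-y\cdot\nabla w(x)\mathbf 1_{B_1}(y)$ if $s=1/2$, and $\delta_yw(x)=w(x+y)-w(x)-y\cdot\nabla w(x)$ if $s>1/2$. For a kernel $K(x,y,t)$, measurable in $y$, let $$Lw(x,t)=\int_{\mathbb R^d}\delta_y w(\cdot,t)(x)\,K(x,y,t)\,dy .$$ (For kernels symmetric in $y$, and for all kernels below if $s\le 1/2$, this is $\mathrm{p.v.}\!\int (w(x+y,t)-w(x,t))K(x,y,t)\,dy$.) Here $\|g\|_{L^\infty(S)}$ is the supremum of $|g|$ over $S$, and $\partial_t$ is the left derivative in time. A bounded function $u$ on $\mathbb R^d\times I_R$ with measurable time slices is a *viscosity subsolution*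 of $\partial_tu-Lu=f$ in $B_R\times I_R$ if it is upper semicontinuous in $B_R\times I_R$ and the following holds for all $(x_0,t_0)\in B_R\times I_R$ and $\varepsilon>0$ with $C_\varepsilon:=B_\varepsilon(x_0)\times(t_0-\varepsilon,t_0]\subseteq B_R\times I_R$. For each $\varphi:C_\varepsilon\to\mathbb R$ that is left-differentiable in time and $C^{1,1}$ in space, with $\varphi(x_0,t_0)=u(x_0,t_0)$ and $\varphi\ge u$ in $C_\varepsilon$, the function $v$ equal to $\varphi$ in $C_\varepsilon$ and to $u$ elsewhere satisfies $\partial_tv(x_0,t_0)-Lv(x_0,t_0)\le f(x_0,t_0)$. A *supersolution* is defined with lower semicontinuity, $\varphi\le u$ in $C_\varepsilon$ and the opposite final inequality. A *viscosity solution* is both. **Theorem.** There exist $\alpha\in(0,2s)$ and $C>0$, depending only on $d,s,\lambda,\Lambda$, such that the following holds for all $R>\rho>0$. Let $K(x,\cdot,t)$ be measurable with $$\lambda\min\{|y|^{-d-2s},\rho^{-d-2s}\}\le K(x,y,t)\le\Lambda|y|^{-d-2s}\qquad (y\ne0)$$ for all $(x,t)\in B_R\times I_R$ and, if $s=1/2$,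 also $K(x,y,t)=K(x,-y,t)$. Let $f$ be bounded on $B_R\times I_R$, and let the bounded function $u$ on $\mathbb R^d\times I_R$ be a viscosity solution of $\partial_tu-Lu=f$ in $B_R\times I_R$. Then $$\sup_{\substack{(x,t),(y,\tau)\in B_{R/2}\times I_{R/2}\\ d((x,t),(y,\tau))>\rho}}\frac{|u(x,t)-u(y,\tau)|}{d((x,t),(y,\tau))^\alpha}\le\frac{C}{R^\alpha}\left(\|u\|_{L^\infty(\mathbb R^d\times I_R)}+R^{2s}\|f\|_{L^\infty(B_R\times I_R)}\right).$$ -/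

import Mathlib

namespace NonlocalParabolic

noncomputable section

/-- The space `ℝ^d` with its Euclidean norm. -/
abbrev Space (d : ℕ) : Type := EuclideanSpace ℝ (Fin d)

/-- The time interval `I_R = (-R^{2s}, 0]`. -/
def timeInterval (s R : ℝ) : Set ℝ := Set.Ioc (-R ^ (2 * s)) 0

/-- The parabolic distance `max {|x - y|, |t - τ|^{1/(2s)}}`. -/
def parabolicDist {d : ℕ} (s : ℝ) (p q : Space d × ℝ) : ℝ :=
  max (dist p.1 q.1) (|p.2 - q.2| ^ (1 / (2 * s)))

/-- The difference `δ_y w(x)`: no gradient correction for `s < 1/2`, a gradient correction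
on the unit ball for `s = 1/2`, and a full gradient correction for `s > 1/2`. -/
def delta {d : ℕ} (s : ℝ) (w : Space d → ℝ) (x y : Space d) : ℝ :=
  if s < 1 / 2 then w (x + y) - w x
  else if s = 1 / 2 then
    w (x + y) - w x - (Metric.ball (0 : Space d) 1).indicator (fun z => inner ℝ z (gradient w x)) y
  else w (x + y) - w x - inner ℝ y (gradient w x)

/-- The linear operator `(Lw)(x,t) = ∫ δ_y w(·,t)(x) K(x,y,t) dy`. -/
def linearOperator {d : ℕ} (s : ℝ) (K : Space d → Space d → ℝ → ℝ)
    (w : Space d → ℝ → ℝ) (x : Space d) (t : ℝ) : ℝ :=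
  ∫ y, delta s (fun z => w z t) x y * K x y t

/-- The left derivative in time. -/
def leftTimeDeriv {d : ℕ} (w : Space d → ℝ → ℝ) (x : Space d) (t : ℝ) : ℝ :=
  derivWithin (w x) (Set.Iic t) t

/-- The backward cylinder `B_ε(x₀) × (t₀ - ε, t₀]`. -/
def backwardCylinder {d : ℕ} (x₀ : Space d) (t₀ ε : ℝ) : Set (Space d × ℝ) :=
  Metric.ball x₀ ε ×ˢ Set.Ioc (t₀ - ε) t₀

/-- `g ∈ C^{1,1}(U)`, `U` open: `g` is differentiable in `U` with Lipschitz gradient. -/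
def IsC11On {d : ℕ} (g : Space d → ℝ) (U : Set (Space d)) : Prop :=
  DifferentiableOn ℝ g U ∧ ∃ M : NNReal, LipschitzOnWith M (gradient g) U

/-- Admissible test functions on `B_ε(x₀) × (t₀ - ε, t₀]`: left-differentiable in time and
`C^{1,1}` in space. Only the values of `φ` on this cylinder matter. -/
def IsTestFunction {d : ℕ} (φ : Space d → ℝ → ℝ) (x₀ : Space d) (t₀ ε : ℝ) : Prop :=
  (∀ x ∈ Metric.ball x₀ ε, ∀ t ∈ Set.Ioc (t₀ - ε) t₀,
    DifferentiableWithinAt ℝ (φ x) (Set.Iic t) t) ∧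
  ∀ t ∈ Set.Ioc (t₀ - ε) t₀, IsC11On (fun x => φ x t) (Metric.ball x₀ ε)

open Classical in
/-- The function equal to `φ` in `B_ε(x₀) × (t₀ - ε, t₀]` and to `u` elsewhere. -/
def glue {d : ℕ} (u φ : Space d → ℝ → ℝ) (x₀ : Space d) (t₀ ε : ℝ) :
    Space d → ℝ → ℝ :=
  fun x t => if (x, t) ∈ backwardCylinder x₀ t₀ ε then φ x t else u x t

/-- `u` is a bounded function on `ℝ^d × I` all of whose time slices are measurable. -/
def IsBoundedMeasurable {d : ℕ} (u : Space d → ℝ → ℝ) (I : Set ℝ) : Prop :=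
  (∃ M : ℝ, ∀ x, ∀ t ∈ I, |u x t| ≤ M) ∧
  ∀ t ∈ I, AEMeasurable (fun x => u x t) MeasureTheory.volume

/-- `∂ₜu - F(u) ≤ f` in `Ω × I` in the viscosity sense. -/
structure IsViscositySubsolution {d : ℕ} (F : (Space d → ℝ → ℝ) → Space d → ℝ → ℝ)
    (f : Space d → ℝ → ℝ) (Ω : Set (Space d)) (I : Set ℝ) (u : Space d → ℝ → ℝ) : Prop where
  bounded : IsBoundedMeasurable u I
  semicontinuous : UpperSemicontinuousOn (fun p : Space d × ℝ => u p.1 p.2) (Ω ×ˢ I)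
  le_of_touching : ∀ x₀ ∈ Ω, ∀ t₀ ∈ I, ∀ ε > 0, backwardCylinder x₀ t₀ ε ⊆ Ω ×ˢ I →
    ∀ φ : Space d → ℝ → ℝ, IsTestFunction φ x₀ t₀ ε → u x₀ t₀ = φ x₀ t₀ →
      (∀ p ∈ backwardCylinder x₀ t₀ ε, u p.1 p.2 ≤ φ p.1 p.2) →
      leftTimeDeriv (glue u φ x₀ t₀ ε) x₀ t₀ - F (glue u φ x₀ t₀ ε) x₀ t₀ ≤ f x₀ t₀

/-- `∂ₜu - F(u) ≥ f` in `Ω × I` in the viscosity sense. -/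
structure IsViscositySupersolution {d : ℕ} (F : (Space d → ℝ → ℝ) → Space d → ℝ → ℝ)
    (f : Space d → ℝ → ℝ) (Ω : Set (Space d)) (I : Set ℝ) (u : Space d → ℝ → ℝ) : Prop where
  bounded : IsBoundedMeasurable u I
  semicontinuous : LowerSemicontinuousOn (fun p : Space d × ℝ => u p.1 p.2) (Ω ×ˢ I)
  ge_of_touching : ∀ x₀ ∈ Ω, ∀ t₀ ∈ I, ∀ ε > 0, backwardCylinder x₀ t₀ ε ⊆ Ω ×ˢ I →
    ∀ φ : Space d → ℝ → ℝ, IsTestFunction φ x₀ t₀ ε → u x₀ t₀ = φ x₀ t₀ →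
      (∀ p ∈ backwardCylinder x₀ t₀ ε, φ p.1 p.2 ≤ u p.1 p.2) →
      f x₀ t₀ ≤ leftTimeDeriv (glue u φ x₀ t₀ ε) x₀ t₀ - F (glue u φ x₀ t₀ ε) x₀ t₀

/-- `∂ₜu - F(u) = f` in `Ω × I` in the viscosity sense. -/
def IsViscositySolution {d : ℕ} (F : (Space d → ℝ → ℝ) → Space d → ℝ → ℝ)
    (f : Space d → ℝ → ℝ) (Ω : Set (Space d)) (I : Set ℝ) (u : Space d → ℝ → ℝ) : Prop :=
  IsViscositySubsolution F f Ω I u ∧ IsViscositySupersolution F f Ω I u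

/-- The kernel assumptions at the points `(x,t)` of `B_R × I_R`. -/
structure IsAdmissibleKernel {d : ℕ} (s lam Lam ρ R : ℝ)
    (K : Space d → Space d → ℝ → ℝ) : Prop where
  measurable : ∀ x ∈ Metric.ball (0 : Space d) R, ∀ t ∈ timeInterval s R,
    AEMeasurable (fun y => K x y t) MeasureTheory.volume
  lower : ∀ x ∈ Metric.ball (0 : Space d) R, ∀ t ∈ timeInterval s R, ∀ y, y ≠ 0 →
    lam * min (‖y‖ ^ (-(d : ℝ) - 2 * s)) (ρ ^ (-(d : ℝ) - 2 * s)) ≤ K x y t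
  upper : ∀ x ∈ Metric.ball (0 : Space d) R, ∀ t ∈ timeInterval s R, ∀ y, y ≠ 0 →
    K x y t ≤ Lam * ‖y‖ ^ (-(d : ℝ) - 2 * s)
  symmetric : s = 1 / 2 → ∀ x ∈ Metric.ball (0 : Space d) R, ∀ t ∈ timeInterval s R,
    ∀ y, K x y t = K x (-y) t

/-- The supremum of `|g|` over `S`. -/
def supNormOn {d : ℕ} (g : Space d → ℝ → ℝ) (S : Set (Space d × ℝ)) : ℝ :=
  sSup ((fun p : Space d × ℝ => |g p.1 p.2|) '' S)

end

end NonlocalParabolic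

/-! The oscillation of `u` decays geometrically on parabolic cylinders that shrink by a factor `N`
about a fixed vertex, as long as their radius stays above `ρ`.

One step rests on `growth_lemma`. Suppose `l ≤ u ≤ l + 2a` on a cylinder of radius `N r`. Then `u -
l` or `l + 2a - u` has mean at least `a` over the ball of radius `r` and the earlier half of the
time interval; call that function `w`. The operator is nonlocal and `K ≥ ℓ` at distances up to `(N +
1) r`, so the mass of `w` on the small ball pushes `w` up at every point of the large ball at once.
The pointwise lower bound on `K` thus replaces any measure-theoretic covering argument, and a
barrier makes the push quantitative: `m(t) * bump - A * penalty - η (t - t₁)`, with `m' = ℓ ∫ w - b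
m` and `m(t₁) = 0`. The operator applied to `bump` is at least a negative multiple of `bump` itself,
of order `r ^ (-2s)` (`scaledDelta_bump_ge`), so this loss fits into the rate `b`. The `penalty`
grows like `|x| ^ s` and keeps the barrier below `w` outside the large ball, where `w` may be
negative; inside, its cost is small for large `N` (`scaledDelta_penalty_le`). If the barrier crossed
`w`, a lowered copy would touch `w` from below and the equation would fail there (`barrier_le`).

The lower bound for `w` shortens the interval of values of `u` by the factor `N ^ (-α)`. The
power-type tail bound in `HasOscillationBound` reproduces itself from one scale to the next, so the
step iterates. The truncation of the kernel at `ρ` enters only through the condition `ρ ≤ (N + 1)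
r`. -/

namespace NonlocalParabolic

noncomputable section

open MeasureTheory Metric Set Filter Topology

variable {d : ℕ}

/-! ### Radial profiles and their integrals against the fractional kernel -/

/-- Exponent near the origin of the profile dominating first or second differences. -/
def nearExp (s : ℝ) : ℝ := if s < 1 / 2 then 1 else 2

/-- Exponent at infinity of the profile dominating first or second differences. -/
def farExp (s : ℝ) : ℝ := if s ≤ 1 / 2 then s else 1

/-- The radial profile `z ^ nearExp s` for `z < 1` and `z ^ farExp s` for `z ≥ 1`. -/
def profile (s z : ℝ) : ℝ := if z < 1 then z ^ nearExp s else z ^ farExp s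

lemma profile_nonneg {s z : ℝ} (hz : 0 ≤ z) : 0 ≤ profile s z := by
  unfold profile; split_ifs <;> positivity

/-- `δ_y w` vanishes to first order at `y = 0` without gradient correction and to second order with
it. At infinity it grows at most like `|y| ^ s` (the penalty), or linearly when the gradient term is
not cut off. The resulting exponents lie on the two sides of `2s`, as integrability demands. -/
lemma two_mul_lt_nearExp {s : ℝ} (hs : s ∈ Ioo (0 : ℝ) 1) : 2 * s < nearExp s := by
  unfold nearExp; split_ifs <;> linarith [hs.2]

lemma farExp_lt_two_mul {s : ℝ} (hs : s ∈ Ioo (0 : ℝ) 1) : farExp s < 2 * s := by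
  unfold farExp; split_ifs <;> linarith [hs.1]

lemma le_farExp {s : ℝ} (hs : s ∈ Ioo (0 : ℝ) 1) : s ≤ farExp s := by
  unfold farExp; split_ifs <;> linarith [hs.2]

lemma farExp_pos {s : ℝ} (hs : s ∈ Ioo (0 : ℝ) 1) : 0 < farExp s := hs.1.trans_le (le_farExp hs)

lemma nearExp_le_two (s : ℝ) : nearExp s ≤ 2 := by
  unfold nearExp; split_ifs <;> norm_num

lemma measurable_profile (s : ℝ) : Measurable (profile s) := by
  unfold profile
  exact Measurable.ite measurableSet_Iio (by fun_prop) (by fun_prop)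


/-- In polar coordinates the integrand is `z ^ (nearExp s - 2s - 1)` on `(0,1)` and `z ^ (farExp s -
2s - 1)` beyond; both converge because `farExp s < 2s < nearExp s`. -/
lemma integrable_profile {s : ℝ} (hd : 1 ≤ d) (hs : s ∈ Ioo (0 : ℝ) 1) :
    Integrable (fun y : Space d => profile s ‖y‖ * ‖y‖ ^ (-(d : ℝ) - 2 * s)) := by
  have : Nonempty (Fin d) := ⟨⟨0, hd⟩⟩
  have key := (integrable_fun_norm_addHaar (volume : Measure (Space d))
    (f := fun z : ℝ => profile s z * z ^ (-(d : ℝ) - 2 * s))).2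
  refine key ?_
  have hdim : Module.finrank ℝ (Space d) = d := by simp
  rw [hdim, ← Ioo_union_Ici_eq_Ioi (zero_lt_one' ℝ)]
  refine IntegrableOn.union ?_ ?_
  · have h1 : IntegrableOn (fun z : ℝ => z ^ (nearExp s - 2 * s - 1)) (Ioo 0 1) :=
      (intervalIntegral.integrableOn_Ioo_rpow_iff zero_lt_one).2
        (by linarith [two_mul_lt_nearExp hs])
    refine h1.congr_fun ?_ measurableSet_Ioo
    rintro z ⟨hz0, hz1⟩
    simp only [profile, hz1, if_true, smul_eq_mul]
    rw [← Real.rpow_natCast, ← Real.rpow_add hz0, ← Real.rpow_add hz0]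
    congr 1
    push_cast [Nat.cast_sub hd]
    ring
  · rw [integrableOn_Ici_iff_integrableOn_Ioi]
    have h1 : IntegrableOn (fun z : ℝ => z ^ (farExp s - 2 * s - 1)) (Ioi 1) :=
      integrableOn_Ioi_rpow_of_lt (by linarith [farExp_lt_two_mul hs]) zero_lt_one
    refine h1.congr_fun ?_ measurableSet_Ioi
    intro z hz
    have hz1 : (1 : ℝ) < z := hz
    have hz0 : 0 < z := zero_lt_one.trans hz1
    simp only [profile, not_lt.2 hz1.le, if_false, smul_eq_mul]
    rw [← Real.rpow_natCast, ← Real.rpow_add hz0, ← Real.rpow_add hz0]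
    congr 1
    push_cast [Nat.cast_sub hd]
    ring

/-- The integral of the profile against the fractional kernel. -/
def profileIntegral (d : ℕ) (s : ℝ) : ℝ :=
  ∫ y : Space d, profile s ‖y‖ * ‖y‖ ^ (-(d : ℝ) - 2 * s)

lemma profileIntegral_nonneg (d : ℕ) (s : ℝ) : 0 ≤ profileIntegral d s :=
  integral_nonneg fun _ => mul_nonneg (profile_nonneg (norm_nonneg _)) (by positivity)

lemma scaled_profile_eq {s q : ℝ} (hq : 0 < q) (y : Space d) :
    profile s (‖y‖ / q) * ‖y‖ ^ (-(d : ℝ) - 2 * s) = q ^ (-(d : ℝ) - 2 * s) *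
      (profile s ‖q⁻¹ • y‖ * ‖q⁻¹ • y‖ ^ (-(d : ℝ) - 2 * s)) := by
  have h1 : ‖q⁻¹ • y‖ = ‖y‖ / q := by
    rw [norm_smul, norm_inv, Real.norm_of_nonneg hq.le]; field_simp
  rw [h1, Real.div_rpow (norm_nonneg _) hq.le]
  have := (Real.rpow_pos_of_pos hq (-(d : ℝ) - 2 * s)).ne'
  field_simp

lemma integrable_scaled_profile {s q : ℝ} (hd : 1 ≤ d) (hs : s ∈ Ioo (0 : ℝ) 1) (hq : 0 < q) :
    Integrable (fun y : Space d => profile s (‖y‖ / q) * ‖y‖ ^ (-(d : ℝ) - 2 * s)) := by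
  simp_rw [scaled_profile_eq hq]
  exact ((integrable_profile hd hs).comp_smul (inv_ne_zero hq.ne')).const_mul _

lemma integral_scaled_profile {s q : ℝ} (hq : 0 < q) :
    ∫ y : Space d, profile s (‖y‖ / q) * ‖y‖ ^ (-(d : ℝ) - 2 * s) =
      q ^ (-2 * s) * profileIntegral d s := by
  simp_rw [scaled_profile_eq hq]
  rw [integral_const_mul, Measure.integral_comp_inv_smul_of_nonneg volume
    (fun y : Space d => profile s ‖y‖ * ‖y‖ ^ (-(d : ℝ) - 2 * s)) hq.le, finrank_euclideanSpace,
    Fintype.card_fin, smul_eq_mul, ← mul_assoc, ← Real.rpow_natCast, ← Real.rpow_add hq]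
  unfold profileIntegral
  congr 2
  ring

/-- Densities dominated by the fractional kernel, and symmetric when `s = 1/2`. -/
structure IsLevyDensity (s Lam : ℝ) (k : Space d → ℝ) : Prop where
  aemeasurable : AEMeasurable k
  nonneg : ∀ y, y ≠ 0 → 0 ≤ k y
  upper : ∀ y, y ≠ 0 → k y ≤ Lam * ‖y‖ ^ (-(d : ℝ) - 2 * s)
  symmetric : s = 1 / 2 → ∀ y, k y = k (-y)

lemma ae_ne_zero (hd : 1 ≤ d) : ∀ᵐ y : Space d, y ≠ 0 := by
  have : Nonempty (Fin d) := ⟨⟨0, hd⟩⟩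
  exact compl_mem_ae_iff.2 (measure_singleton 0)

lemma IsLevyDensity.integrable_profile_mul {s Lam q : ℝ} {k : Space d → ℝ} (hd : 1 ≤ d)
    (hs : s ∈ Ioo (0 : ℝ) 1) (hk : IsLevyDensity s Lam k) (hq : 0 < q) :
    Integrable (fun y => profile s (‖y‖ / q) * k y) := by
  refine ((integrable_scaled_profile hd hs hq).const_mul Lam).mono ?_ ?_
  · have hm : Measurable fun y : Space d => profile s (‖y‖ / q) :=
      (measurable_profile s).comp (measurable_norm.div_const q)
    exact (hm.aemeasurable.mul hk.aemeasurable).aestronglyMeasurable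
  · filter_upwards [ae_ne_zero hd] with y hy
    have h0 : 0 ≤ profile s (‖y‖ / q) := profile_nonneg (by positivity)
    have h1 := hk.upper y hy
    have h2 := hk.nonneg y hy
    rw [Real.norm_of_nonneg (mul_nonneg h0 h2)]
    refine le_trans ?_ (Real.le_norm_self _)
    nlinarith

lemma IsLevyDensity.integrable_mul {s Lam C : ℝ} {k G : Space d → ℝ} (hd : 1 ≤ d)
    (hs : s ∈ Ioo (0 : ℝ) 1) (hk : IsLevyDensity s Lam k) (hG : AEMeasurable G)
    (hC : ∀ y, |G y| ≤ C * profile s ‖y‖) : Integrable (fun y => G y * k y) := by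
  refine ((hk.integrable_profile_mul hd hs zero_lt_one).const_mul C).mono
    (hG.mul hk.aemeasurable).aestronglyMeasurable ?_
  filter_upwards [ae_ne_zero hd] with y hy
  refine le_trans ?_ (Real.le_norm_self _)
  have h2 := hk.nonneg y hy
  rw [norm_mul, Real.norm_eq_abs, Real.norm_of_nonneg h2, div_one, ← mul_assoc]
  exact mul_le_mul_of_nonneg_right (hC y) h2

lemma IsLevyDensity.le_integral_mul {s Lam c q : ℝ} {k G : Space d → ℝ} (hd : 1 ≤ d)
    (hs : s ∈ Ioo (0 : ℝ) 1) (hk : IsLevyDensity s Lam k) (hq : 0 < q) (hc : 0 ≤ c)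
    (hint : Integrable fun y => G y * k y) (hG : ∀ y, -(c * profile s (‖y‖ / q)) ≤ G y) :
    -(c * (Lam * profileIntegral d s * q ^ (-2 * s))) ≤ ∫ y, G y * k y := by
  have h1 : ∫ y : Space d, -(c * Lam) * (profile s (‖y‖ / q) * ‖y‖ ^ (-(d : ℝ) - 2 * s)) ≤
      ∫ y, G y * k y := by
    refine integral_mono_ae ((integrable_scaled_profile hd hs hq).const_mul _) hint ?_
    filter_upwards [ae_ne_zero hd] with y hy
    have h0 : 0 ≤ profile s (‖y‖ / q) := profile_nonneg (by positivity)
    have h2 := mul_le_mul_of_nonneg_right (hG y) (hk.nonneg y hy)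
    have h3 := mul_le_mul_of_nonneg_left (hk.upper y hy) (mul_nonneg hc h0)
    nlinarith
  rw [integral_const_mul, integral_scaled_profile hq] at h1
  linarith

/-! ### Moving the gradient cutoff to an arbitrary scale -/

/-- The cutoff multiplying the gradient correction, at scale `q`. -/
def cutoff (s q : ℝ) (y : Space d) : ℝ :=
  if s < 1 / 2 then 0 else if s = 1 / 2 then (ball (0 : Space d) q).indicator 1 y else 1

/-- The difference `δ_y w(x)` with the gradient correction cut off at scale `q`. -/
def scaledDelta (s q : ℝ) (w : Space d → ℝ) (x y : Space d) : ℝ :=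
  w (x + y) - w x - cutoff s q y * inner ℝ y (gradient w x)

lemma delta_eq_scaledDelta (s : ℝ) (w : Space d → ℝ) (x y : Space d) :
    delta s w x y = scaledDelta s 1 w x y := by
  unfold delta scaledDelta cutoff
  split_ifs with h1 h2
  · simp
  · by_cases hy : y ∈ ball (0 : Space d) 1 <;> simp [indicator, hy]
  · simp

lemma measurable_cutoff (s q : ℝ) : Measurable (cutoff s q : Space d → ℝ) := by
  unfold cutoff
  split_ifs
  · exact measurable_const
  · exact measurable_one.indicator measurableSet_ball
  · exact measurable_const

lemma cutoff_mem (s q : ℝ) (y : Space d) : 0 ≤ cutoff s q y ∧ cutoff s q y ≤ 1 := by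
  unfold cutoff
  split_ifs
  · simp
  · by_cases hy : y ∈ ball (0 : Space d) q <;> simp [indicator, hy]
  · simp

/-- The cutoff depends on the scale only for `s = 1/2`; the difference then lives on an annulus away
from the origin. -/
lemma integrable_cutoff_sub_mul {s Lam q : ℝ} {k : Space d → ℝ} (hd : 1 ≤ d)
    (hs : s ∈ Ioo (0 : ℝ) 1) (hk : IsLevyDensity s Lam k) (hq : 0 < q) (p : Space d) :
    Integrable (fun y => ((cutoff s 1 y - cutoff s q y) * inner ℝ y p) * k y) := by
  by_cases h : s = 1 / 2
  · subst h
    have hm : 0 < min 1 q := lt_min one_pos hq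
    -- On the annulus `min 1 q ≤ ‖y‖ < max 1 q`, the length `‖y‖` is at most `(min 1 q)⁻¹ ‖y‖²` when
    -- `‖y‖ < 1`, and at most `max 1 q` when `‖y‖ ≥ 1`, where the profile is at least `1`.
    refine hk.integrable_mul (C := ‖p‖ * (max 1 q + (min 1 q)⁻¹)) hd hs ?_ ?_
    · exact (((measurable_cutoff _ _).sub (measurable_cutoff _ _)).mul
        (by fun_prop)).aemeasurable
    · intro y
      have hin : |inner ℝ y p| ≤ ‖y‖ * ‖p‖ := abs_real_inner_le_norm y p
      have hpr := profile_nonneg (s := 1 / 2) (norm_nonneg y)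
      have hM : 0 ≤ max 1 q := le_max_of_le_left zero_le_one
      rcases lt_or_ge ‖y‖ (min 1 q) with hy | hy
      · have h1 : y ∈ ball (0 : Space d) 1 := by simpa using hy.trans_le (min_le_left _ _)
        have h2 : y ∈ ball (0 : Space d) q := by simpa using hy.trans_le (min_le_right _ _)
        simp only [cutoff, lt_irrefl, if_false, if_true, indicator_of_mem h1,
          indicator_of_mem h2, sub_self, zero_mul, abs_zero]
        positivity
      · rcases le_or_gt (max 1 q) ‖y‖ with hy' | hy'
        · have h1 : y ∉ ball (0 : Space d) 1 := by
            simpa using (le_max_left _ _).trans hy'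
          have h2 : y ∉ ball (0 : Space d) q := by
            simpa using (le_max_right _ _).trans hy'
          simp only [cutoff, lt_irrefl, if_false, if_true, indicator_of_notMem h1,
            indicator_of_notMem h2, sub_self, zero_mul, abs_zero]
          positivity
        · have hc : |cutoff (1 / 2) 1 y - cutoff (1 / 2) q y| ≤ 1 := by
            have h1 := cutoff_mem (1 / 2) 1 y
            have h2 := cutoff_mem (1 / 2) q y
            rw [abs_le]; constructor <;> linarith [h1.1, h1.2, h2.1, h2.2]
          rw [abs_mul]
          have h3 : |cutoff (1 / 2) 1 y - cutoff (1 / 2) q y| * |inner ℝ y p| ≤ ‖y‖ * ‖p‖ := by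
            nlinarith [abs_nonneg (inner ℝ y p)]
          refine h3.trans ?_
          have h4 : ‖y‖ ≤ (max 1 q + (min 1 q)⁻¹) * profile (1 / 2) ‖y‖ := by
            unfold profile nearExp farExp
            have hypos : 0 < ‖y‖ := hm.trans_le hy
            split_ifs with h5
            · exact absurd ‹(1 : ℝ) / 2 < 1 / 2› (lt_irrefl _)
            · rw [Real.rpow_two]
              have : ‖y‖ ≤ (min 1 q)⁻¹ * ‖y‖ ^ 2 := by
                rw [← div_eq_inv_mul, le_div_iff₀ hm]; nlinarith
              nlinarith [sq_nonneg ‖y‖]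
            · have h6 : 1 ≤ ‖y‖ ^ ((1 : ℝ) / 2) :=
                Real.one_le_rpow (not_lt.1 h5) (by norm_num)
              have h7 : 0 < (min 1 q)⁻¹ := inv_pos.2 hm
              nlinarith
            · exact absurd (le_refl ((1 : ℝ) / 2)) ‹_›
          calc ‖y‖ * ‖p‖ ≤ ((max 1 q + (min 1 q)⁻¹) * profile (1 / 2) ‖y‖) * ‖p‖ := by gcongr
            _ = _ := by ring
  · have : (fun y => ((cutoff s 1 y - cutoff s q y) * inner ℝ y p) * k y) = fun _ => 0 := by
      funext y
      simp only [cutoff, if_neg h, sub_self, zero_mul]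
    rw [this]
    exact integrable_zero _ _ _

/-- The integrand is odd when `s = 1/2`. This is the only use of the symmetry of the kernel, and it
makes the estimates scale invariant although `delta` cuts off at the fixed radius `1`. -/
lemma integral_cutoff_sub_mul {s Lam q : ℝ} {k : Space d → ℝ}
    (hk : IsLevyDensity s Lam k) (p : Space d) :
    ∫ y, ((cutoff s 1 y - cutoff s q y) * inner ℝ y p) * k y = 0 := by
  by_cases h : s = 1 / 2
  · have hodd := integral_neg_eq_self
      (fun y => ((cutoff s 1 y - cutoff s q y) * inner ℝ y p) * k y) (volume : Measure (Space d))
    have hneg : ∀ (a : ℝ) (y : Space d), cutoff s a (-y) = cutoff s a y := by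
      intro a y; simp [cutoff, indicator]
    have h2 : ∀ y, ((cutoff s 1 (-y) - cutoff s q (-y)) * inner ℝ (-y) p) * k (-y) =
        -(((cutoff s 1 y - cutoff s q y) * inner ℝ y p) * k y) := by
      intro y
      rw [hneg, hneg, inner_neg_left, ← hk.symmetric h y]; ring
    simp_rw [h2] at hodd
    rw [integral_neg] at hodd
    linarith
  · simp only [cutoff, if_neg h, sub_self, zero_mul, integral_zero]

/-- Lower bound for the integral of `δ_y w(x)` against a Lévy density, from a pointwise lower
bound at any scale. -/
lemma IsLevyDensity.le_integral_delta {s Lam c q : ℝ} {k w : Space d → ℝ} {x : Space d}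
    (hd : 1 ≤ d) (hs : s ∈ Ioo (0 : ℝ) 1) (hk : IsLevyDensity s Lam k) (hq : 0 < q) (hc : 0 ≤ c)
    (hint : Integrable fun y => delta s w x y * k y)
    (hw : ∀ y, -(c * profile s (‖y‖ / q)) ≤ scaledDelta s q w x y) :
    -(c * (Lam * profileIntegral d s * q ^ (-2 * s))) ≤ ∫ y, delta s w x y * k y := by
  have hD := integrable_cutoff_sub_mul hd hs hk hq (gradient w x)
  have heq : ∀ y, scaledDelta s q w x y * k y = delta s w x y * k y +
      ((cutoff s 1 y - cutoff s q y) * inner ℝ y (gradient w x)) * k y := by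
    intro y; rw [delta_eq_scaledDelta]; unfold scaledDelta; ring
  have hint' : Integrable fun y => scaledDelta s q w x y * k y := by
    simp_rw [heq]; exact hint.add hD
  have h := hk.le_integral_mul hd hs hq hc hint' hw
  simp_rw [heq] at h
  rwa [integral_add hint hD, integral_cutoff_sub_mul hk, add_zero] at h

/-! ### Integrability of differences of `C^{1,1}` functions -/

/-- Mean value inequality for `g` minus its linear part, on the closed ball of radius `‖y‖`, where
the gradient varies by at most `M ‖y‖`. -/
lemma IsC11On.exists_taylor_bound {g : Space d → ℝ} {x : Space d} {ε : ℝ}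
    (hg : IsC11On g (ball x ε)) :
    ∃ M : ℝ, 0 ≤ M ∧ ∀ y, ‖y‖ < ε → |g (x + y) - g x - inner ℝ y (gradient g x)| ≤ M * ‖y‖ ^ 2 := by
  obtain ⟨hdiff, M, hM⟩ := hg
  refine ⟨M, M.2, fun y hy => ?_⟩
  have hsub : closedBall x ‖y‖ ⊆ ball x ε := closedBall_subset_ball hy
  have hx : x ∈ closedBall x ‖y‖ := mem_closedBall_self (norm_nonneg y)
  have h := (convex_closedBall x ‖y‖).norm_image_sub_le_of_norm_fderiv_le' (𝕜 := ℝ) (f := g)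
    (φ := fderiv ℝ g x) (C := M * ‖y‖) (x := x) (y := x + y)
    (fun z hz => (hdiff z (hsub hz)).differentiableAt (isOpen_ball.mem_nhds (hsub hz)))
    (fun z hz => by
      rw [← toDual_gradient, ← toDual_gradient, ← map_sub, LinearIsometryEquiv.norm_map,
        ← dist_eq_norm]
      exact (hM.dist_le_mul z (hsub hz) x (hsub hx)).trans
        (mul_le_mul_of_nonneg_left (mem_closedBall.1 hz) M.2))
    hx (by simp)
  rw [add_sub_cancel_left, ← inner_gradient_left, real_inner_comm, Real.norm_eq_abs] at h
  calc _ ≤ _ := h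
    _ = _ := by ring

lemma aemeasurable_comp_add_left {w : Space d → ℝ} (hw : AEMeasurable w) (x : Space d) :
    AEMeasurable fun y => w (x + y) :=
  hw.comp_quasiMeasurePreserving (quasiMeasurePreserving_add_left volume x)

lemma aemeasurable_delta {s : ℝ} {w : Space d → ℝ} (hw : AEMeasurable w) (x : Space d) :
    AEMeasurable (delta s w x) := by
  have : delta s w x = fun y => w (x + y) - w x - cutoff s 1 y * inner ℝ y (gradient w x) := by
    funext y; rw [delta_eq_scaledDelta]; rfl
  rw [this]
  refine ((aemeasurable_comp_add_left hw x).sub aemeasurable_const).sub ?_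
  exact ((measurable_cutoff s 1).mul (by fun_prop)).aemeasurable

/-- Taylor expansion controls small `y`, the growth bound the rest. The constant depends on `w` and
`x` and serves integrability only; growth of order `s` is allowed so that the penalty is covered. -/
lemma exists_delta_le_profile {s C ε : ℝ} {w : Space d → ℝ} {x : Space d}
    (hs : s ∈ Ioo (0 : ℝ) 1) (hε : 0 < ε) (hreg : IsC11On w (ball x ε))
    (hgrow : ∀ y, |w (x + y)| ≤ C * (1 + ‖y‖ ^ s)) :
    ∃ C', ∀ y, |delta s w x y| ≤ C' * profile s ‖y‖ := by
  obtain ⟨M, hM0, hM⟩ := hreg.exists_taylor_bound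
  have hC : 0 ≤ C := by
    have := (abs_nonneg _).trans (hgrow 0)
    rw [norm_zero, Real.zero_rpow hs.1.ne'] at this
    linarith
  set p := ‖gradient w x‖ with hp
  have hp0 : 0 ≤ p := norm_nonneg _
  set ε' := min ε 1 with hε'
  have hε'0 : 0 < ε' := lt_min hε one_pos
  have hε'1 : ε' ≤ 1 := min_le_right _ _
  set B := 2 * C + |w x| + p with hB
  have hB0 : 0 ≤ B := by positivity
  -- For `ε' ≤ ‖y‖ < 1` the profile is at least `ε' ^ 2`, since `nearExp s ≤ 2`; the factor `(ε' ^
  -- 2)⁻¹` makes up for this.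
  have hq : (1 : ℝ) ≤ (ε' ^ 2)⁻¹ := (one_le_inv₀ (by positivity)).2 (by nlinarith)
  refine ⟨(M + p) + B * (ε' ^ 2)⁻¹, fun y => ?_⟩
  rw [delta_eq_scaledDelta]
  have hin : |inner ℝ y (gradient w x)| ≤ ‖y‖ * p := abs_real_inner_le_norm _ _
  have hcut := cutoff_mem s 1 y
  have hcut0 := hcut.1
  have hpr := profile_nonneg (s := s) (norm_nonneg y)
  have htri : |scaledDelta s 1 w x y| ≤ |w (x + y)| + |w x| +
      cutoff s 1 y * (‖y‖ * p) := by
    unfold scaledDelta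
    calc _ ≤ |w (x + y) - w x| + |cutoff s 1 y * inner ℝ y (gradient w x)| := abs_sub _ _
      _ ≤ _ := by
        rw [abs_mul, abs_of_nonneg hcut.1]
        gcongr
        exact abs_sub _ _
  rcases lt_or_ge ‖y‖ ε' with hy | hy
  · have hy1 : ‖y‖ < 1 := hy.trans_le hε'1
    have hT := hM y (hy.trans_le (min_le_left _ _))
    have key : |scaledDelta s 1 w x y| ≤ (M + p) * profile s ‖y‖ := by
      unfold profile nearExp scaledDelta cutoff
      rw [if_pos hy1]
      split_ifs with h1 h2
      · rw [Real.rpow_one, zero_mul, sub_zero]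
        have : |w (x + y) - w x| ≤ M * ‖y‖ ^ 2 + ‖y‖ * p := by
          calc |w (x + y) - w x| = |(w (x + y) - w x - inner ℝ y (gradient w x)) +
              inner ℝ y (gradient w x)| := by ring_nf
            _ ≤ _ := (abs_add_le _ _).trans (add_le_add hT hin)
        have h3 : ‖y‖ ^ 2 ≤ ‖y‖ := by nlinarith [norm_nonneg y]
        nlinarith
      · have hmem : y ∈ ball (0 : Space d) 1 := by simpa using hy1
        rw [indicator_of_mem hmem, Pi.one_apply, one_mul, Real.rpow_two]
        nlinarith [sq_nonneg ‖y‖]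
      · rw [one_mul, Real.rpow_two]
        nlinarith [sq_nonneg ‖y‖]
    refine key.trans ?_
    have : 0 ≤ B * (ε' ^ 2)⁻¹ * profile s ‖y‖ := by positivity
    linarith
  · have hy0 : 0 < ‖y‖ := hε'0.trans_le hy
    have key : |scaledDelta s 1 w x y| ≤ B * ((ε' ^ 2)⁻¹ * profile s ‖y‖) := by
      rcases lt_or_ge ‖y‖ 1 with hy1 | hy1
      · have h1 : 1 ≤ (ε' ^ 2)⁻¹ * profile s ‖y‖ := by
          rw [← div_eq_inv_mul, one_le_div (by positivity)]
          unfold profile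
          rw [if_pos hy1, ← Real.rpow_two]
          calc ε' ^ (2 : ℝ) ≤ ‖y‖ ^ (2 : ℝ) := by gcongr
            _ ≤ _ := Real.rpow_le_rpow_of_exponent_ge hy0 hy1.le (nearExp_le_two s)
        have h2 : |scaledDelta s 1 w x y| ≤ B := by
          have h3 := hgrow y
          have h4 : ‖y‖ ^ s ≤ 1 := Real.rpow_le_one (norm_nonneg y) hy1.le hs.1.le
          have h5 : cutoff s 1 y * (‖y‖ * p) ≤ 1 * (1 * p) := by
            gcongr
            exact hcut.2
          nlinarith
        nlinarith
      · have h2 : |scaledDelta s 1 w x y| ≤ B * profile s ‖y‖ := by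
          have h3 := hgrow y
          unfold profile
          rw [if_neg (not_lt.2 hy1)]
          have h4 : ‖y‖ ^ s ≤ ‖y‖ ^ farExp s :=
            Real.rpow_le_rpow_of_exponent_le hy1 (le_farExp hs)
          have h6 : 1 ≤ ‖y‖ ^ farExp s := Real.one_le_rpow hy1 (farExp_pos hs).le
          have h5 : cutoff s 1 y * (‖y‖ * p) ≤ ‖y‖ ^ farExp s * p := by
            unfold cutoff
            split_ifs with h7 h8
            · rw [zero_mul]; positivity
            · have hmem : y ∉ ball (0 : Space d) 1 := by simpa using hy1
              rw [indicator_of_notMem hmem, zero_mul]; positivity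
            · have : farExp s = 1 := by
                unfold farExp
                rw [if_neg]
                intro h9
                exact h8 (le_antisymm h9 (not_lt.1 h7))
              rw [this, Real.rpow_one, one_mul]
          have h7 : |w x| ≤ |w x| * ‖y‖ ^ farExp s := le_mul_of_one_le_right (abs_nonneg _) h6
          nlinarith
        have : B * profile s ‖y‖ * 1 ≤ B * profile s ‖y‖ * (ε' ^ 2)⁻¹ := by gcongr
        linarith
    refine key.trans ?_
    have : 0 ≤ (M + p) * profile s ‖y‖ := by positivity
    linarith

lemma IsLevyDensity.integrable_delta {s Lam C ε : ℝ} {k w : Space d → ℝ} {x : Space d}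
    (hd : 1 ≤ d) (hs : s ∈ Ioo (0 : ℝ) 1) (hk : IsLevyDensity s Lam k) (hw : AEMeasurable w)
    (hε : 0 < ε) (hreg : IsC11On w (ball x ε))
    (hgrow : ∀ y, |w (x + y)| ≤ C * (1 + ‖y‖ ^ s)) :
    Integrable fun y => delta s w x y * k y := by
  obtain ⟨C', hC'⟩ := exists_delta_le_profile hs hε hreg hgrow
  exact hk.integrable_mul hd hs (aemeasurable_delta hw x) hC'

lemma _root_.ContDiff.isC11On_ball {g : Space d → ℝ} (hg : ContDiff ℝ 2 g) (x : Space d) (ε : ℝ) :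
    IsC11On g (ball x ε) := by
  refine ⟨(hg.differentiable (by norm_num)).differentiableOn, ?_⟩
  have h1 : ContDiff ℝ 1 (gradient g) := by
    have : gradient g = fun z => (InnerProductSpace.toDual ℝ (Space d)).symm (fderiv ℝ g z) := rfl
    rw [this]
    exact (InnerProductSpace.toDual ℝ (Space d)).symm.contDiff.comp
      (hg.fderiv_right (m := 1) (by norm_num))
  obtain ⟨M, hM⟩ := h1.contDiffOn.exists_lipschitzOnWith one_ne_zero
    (convex_closedBall x ε) (isCompact_closedBall x ε)
  exact ⟨M, hM.mono ball_subset_closedBall⟩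

/-! ### The bump and the penalty -/

/-- The quadratic function `1 + |x - x̄|² / r²`. -/
def quad (c : Space d) (r : ℝ) (x : Space d) : ℝ := 1 + ‖x - c‖ ^ 2 / r ^ 2

lemma one_le_quad (c : Space d) (r : ℝ) (x : Space d) : 1 ≤ quad c r x := by
  unfold quad; linarith [show 0 ≤ ‖x - c‖ ^ 2 / r ^ 2 by positivity]

lemma quad_pos (c : Space d) (r : ℝ) (x : Space d) : 0 < quad c r x :=
  zero_lt_one.trans_le (one_le_quad c r x)

lemma contDiff_quad (c : Space d) (r : ℝ) : ContDiff ℝ 2 (quad c r) := by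
  unfold quad
  exact contDiff_const.add (((contDiff_id.sub contDiff_const).norm_sq ℝ).div_const _)

lemma quad_add (c : Space d) (r : ℝ) (x y : Space d) :
    quad c r (x + y) = quad c r x + (2 * (inner ℝ (x - c) y / r ^ 2) + ‖y‖ ^ 2 / r ^ 2) := by
  unfold quad
  rw [add_sub_right_comm, norm_add_sq_real]
  ring

lemma hasFDerivAt_quad (c : Space d) (r : ℝ) (x : Space d) :
    HasFDerivAt (quad c r) ((2 / r ^ 2) • innerSL ℝ (x - c)) x := by
  have h := (((hasFDerivAt_id x).sub_const c).norm_sq).mul_const (r ^ 2)⁻¹ |>.const_add 1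
  refine HasFDerivAt.congr_fderiv (h.congr_of_eventuallyEq ?_) ?_
  · exact Eventually.of_forall fun z => by simp [quad, div_eq_mul_inv]
  · ext y; simp; ring

/-- The bump `(1 + |x - x̄|² / r²)⁻¹`. -/
def bump (c : Space d) (r : ℝ) (x : Space d) : ℝ := (quad c r x)⁻¹

/-- The growing function `(1 + |x - x̄|² / q²)^{s/2} - 1`. -/
def penalty (s : ℝ) (c : Space d) (q : ℝ) (x : Space d) : ℝ := quad c q x ^ (s / 2) - 1

lemma bump_pos (c : Space d) (r : ℝ) (x : Space d) : 0 < bump c r x := inv_pos.2 (quad_pos c r x)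

lemma bump_le_one (c : Space d) (r : ℝ) (x : Space d) : bump c r x ≤ 1 :=
  inv_le_one_of_one_le₀ (one_le_quad c r x)

lemma penalty_nonneg {s : ℝ} (hs : 0 ≤ s) (c : Space d) (q : ℝ) (x : Space d) :
    0 ≤ penalty s c q x :=
  sub_nonneg.2 (Real.one_le_rpow (one_le_quad c q x) (by positivity))

lemma contDiff_bump (c : Space d) (r : ℝ) : ContDiff ℝ 2 (bump c r) :=
  (contDiff_quad c r).inv fun x => (quad_pos c r x).ne'

lemma contDiff_penalty (s : ℝ) (c : Space d) (q : ℝ) : ContDiff ℝ 2 (penalty s c q) :=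
  ((contDiff_quad c q).rpow_const_of_ne fun x => (quad_pos c q x).ne').sub contDiff_const

lemma inner_gradient_bump (c : Space d) (r : ℝ) (x y : Space d) :
    inner ℝ y (gradient (bump c r) x) =
      -(2 * (inner ℝ (x - c) y / r ^ 2)) * bump c r x ^ 2 := by
  have h := (hasDerivAt_inv (quad_pos c r x).ne').comp_hasFDerivAt x (hasFDerivAt_quad c r x)
  rw [real_inner_comm, inner_gradient_left]
  have h' : fderiv ℝ (bump c r) x = _ := h.fderiv
  rw [h']
  simp only [bump, smul_apply, innerSL_apply_apply, smul_eq_mul]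
  ring

lemma inner_gradient_penalty (s : ℝ) (c : Space d) (q : ℝ) (x y : Space d) :
    inner ℝ y (gradient (penalty s c q) x) =
      (s / 2 * quad c q x ^ (s / 2 - 1)) * (2 * (inner ℝ (x - c) y / q ^ 2)) := by
  have h := ((hasFDerivAt_quad c q x).rpow_const (p := s / 2)
    (Or.inl (quad_pos c q x).ne')).sub_const 1
  rw [real_inner_comm, inner_gradient_left]
  have h' : fderiv ℝ (penalty s c q) x = _ := h.fderiv
  rw [h']
  simp only [smul_apply, innerSL_apply_apply, smul_eq_mul]
  ring

lemma abs_inner_div_le {c : Space d} {r : ℝ} (hr : 0 < r) (x y : Space d) :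
    |inner ℝ (x - c) y / r ^ 2| ≤ (‖x - c‖ / r) * (‖y‖ / r) := by
  rw [abs_div, abs_of_nonneg (sq_nonneg r), div_mul_div_comm, ← sq]
  gcongr
  exact abs_real_inner_le_norm _ _

lemma farExp_of_gt {s : ℝ} (h1 : ¬s < 1 / 2) (h2 : ¬s = 1 / 2) : farExp s = 1 :=
  if_neg fun h => h2 (le_antisymm h (not_lt.1 h1))

lemma mem_ball_zero_iff_div_lt_one {q : ℝ} (hq : 0 < q) (y : Space d) :
    y ∈ ball (0 : Space d) q ↔ ‖y‖ / q < 1 := by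
  rw [mem_ball_zero_iff, div_lt_one hq]

/-- Convexity of `t ↦ t⁻¹` bounds the bump below by its tangent in `quad`. The point is that the
bound is proportional to `bump c r x`, so that it can be absorbed in an exponential decay of the
barrier height. -/
lemma scaledDelta_bump_ge {s r : ℝ} (hs : s ∈ Ioo (0 : ℝ) 1) (hr : 0 < r) (c x y : Space d) :
    -(2 * bump c r x * profile s (‖y‖ / r)) ≤ scaledDelta s r (bump c r) x y := by
  set z := ‖y‖ / r with hz
  set X := ‖x - c‖ / r with hX
  set i := inner ℝ (x - c) y / r ^ 2 with hi
  set b := bump c r x with hb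
  have hz0 : 0 ≤ z := by positivity
  have hX0 : 0 ≤ X := by positivity
  have hiX : |i| ≤ X * z := abs_inner_div_le hr x y
  have hb0 : 0 < b := bump_pos c r x
  have hb1 : b ≤ 1 := bump_le_one c r x
  have hquad : quad c r x = 1 + X ^ 2 := by rw [hX, div_pow]; rfl
  have hbX : b * (1 + X ^ 2) = 1 := by
    rw [hb, ← hquad]; exact inv_mul_cancel₀ (quad_pos c r x).ne'
  -- This tames the gradient: `|2 i b²| ≤ 2 X z b² ≤ z b`.
  have h2X : 2 * X * b ≤ 1 := by nlinarith [sq_nonneg (X - 1)]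
  have hb' : 0 < bump c r (x + y) := bump_pos c r _
  have hb'eq : bump c r (x + y) * ((1 + X ^ 2) + (2 * i + z ^ 2)) = 1 := by
    have : (1 + X ^ 2) + (2 * i + z ^ 2) = quad c r (x + y) := by
      rw [quad_add, hquad, hi, hz, div_pow ‖y‖]
    rw [this]; exact inv_mul_cancel₀ (quad_pos c r _).ne'
  have htan : b - (2 * i + z ^ 2) * b ^ 2 ≤ bump c r (x + y) := by
    set b' := bump c r (x + y)
    -- The error of the tangent line is an explicit nonnegative square.
    have h1 : b' - b + (2 * i + z ^ 2) * b ^ 2 = b' * (b * (2 * i + z ^ 2)) ^ 2 := by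
      have e1 : (2 * i + z ^ 2) * b' = 1 - b' * (1 + X ^ 2) := by linarith
      have e2 : b' - b = -(b * b' * (2 * i + z ^ 2)) := by
        calc b' - b = b' * (b * (1 + X ^ 2)) - b * (b' * ((1 + X ^ 2) + (2 * i + z ^ 2))) := by
              rw [hbX, hb'eq]; ring
          _ = _ := by ring
      have e3 : b - b' = b * b' * (2 * i + z ^ 2) := by linarith
      calc b' - b + (2 * i + z ^ 2) * b ^ 2 = b * (2 * i + z ^ 2) * (b - b') := by
            rw [e2]; ring
        _ = _ := by rw [e3]; ring
    have h2 : 0 ≤ b' * (b * (2 * i + z ^ 2)) ^ 2 := by positivity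
    linarith
  obtain ⟨hi1, hi2⟩ := abs_le.1 hiX
  unfold scaledDelta
  rw [inner_gradient_bump, ← hi, ← hb]
  unfold profile
  by_cases hz1 : z < 1
  · rw [if_pos hz1]
    unfold nearExp cutoff
    split_ifs with h1 h2
    · rw [Real.rpow_one]
      have : (2 * i + z ^ 2) * b ^ 2 ≤ 2 * b * z := by
        have : (2 * i + z ^ 2) * b ^ 2 ≤ (2 * (X * z) + z) * b ^ 2 := by
          gcongr
          nlinarith
        nlinarith [mul_nonneg hz0 hb0.le]
      linarith
    · rw [indicator_of_mem ((mem_ball_zero_iff_div_lt_one hr y).2 hz1), Pi.one_apply,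
        Real.rpow_two]
      have : z ^ 2 * b ^ 2 ≤ 2 * b * z ^ 2 := by
        nlinarith [mul_nonneg (sq_nonneg z) hb0.le]
      linarith
    · rw [Real.rpow_two]
      have : z ^ 2 * b ^ 2 ≤ 2 * b * z ^ 2 := by
        nlinarith [mul_nonneg (sq_nonneg z) hb0.le]
      linarith
  · rw [if_neg hz1]
    have hone : 1 ≤ z ^ farExp s := Real.one_le_rpow (not_lt.1 hz1) (farExp_pos hs).le
    unfold cutoff
    split_ifs with h1 h2
    · nlinarith
    · rw [indicator_of_notMem (fun h => hz1 ((mem_ball_zero_iff_div_lt_one hr y).1 h))]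
      nlinarith
    · rw [farExp_of_gt h1 h2, Real.rpow_one]
      have hz1' := not_lt.1 hz1
      have : -(b * z) ≤ 2 * i * b ^ 2 := by
        have : -(2 * (X * z) * b ^ 2) ≤ 2 * i * b ^ 2 := by nlinarith [sq_nonneg b]
        nlinarith [mul_nonneg hz0 hb0.le]
      nlinarith

/-- For `‖y‖ < q`, concavity of `t ↦ t ^ (s/2)` puts the function below its tangent; for larger `y`
its subadditivity gives `3 z ^ s`. The gradient term costs at most `z` more, because `‖x - c‖ ≤ q`
gives `|i| ≤ z` and `g ≤ 1/2`. -/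
lemma scaledDelta_penalty_le {s q : ℝ} (hs : s ∈ Ioo (0 : ℝ) 1) (hq : 0 < q) {c x : Space d}
    (hx : ‖x - c‖ ≤ q) (y : Space d) :
    scaledDelta s q (penalty s c q) x y ≤ 4 * profile s (‖y‖ / q) := by
  set z := ‖y‖ / q with hz
  set X := ‖x - c‖ / q with hX
  set i := inner ℝ (x - c) y / q ^ 2 with hi
  set a := quad c q x with ha
  set g := s / 2 * a ^ (s / 2 - 1) with hg
  have hz0 : 0 ≤ z := by positivity
  have hX0 : 0 ≤ X := by positivity
  have hX1 : X ≤ 1 := (div_le_one hq).2 hx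
  have ha1 : 1 ≤ a := one_le_quad c q x
  have ha0 : 0 < a := quad_pos c q x
  have hg0 : 0 ≤ g := by have := hs.1; positivity
  have hg1 : g ≤ 1 / 2 := by
    have : a ^ (s / 2 - 1) ≤ 1 := Real.rpow_le_one_of_one_le_of_nonpos ha1 (by linarith [hs.2])
    have h0 : 0 ≤ a ^ (s / 2 - 1) := by positivity
    nlinarith [hs.1, hs.2]
  have hiX : |i| ≤ X * z := abs_inner_div_le hq x y
  have hiz : |i| ≤ z := hiX.trans (mul_le_of_le_one_left hz0 hX1)
  obtain ⟨hi1, hi2⟩ := abs_le.1 hiz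
  have hadd : quad c q (x + y) = a + (2 * i + z ^ 2) := by rw [quad_add, hz, div_pow]
  have hpos : 0 < a + (2 * i + z ^ 2) := hadd ▸ quad_pos c q (x + y)
  have htan : (a + (2 * i + z ^ 2)) ^ (s / 2) ≤ a ^ (s / 2) + g * (2 * i + z ^ 2) := by
    have h1 : (-1 : ℝ) ≤ (2 * i + z ^ 2) / a := by rw [le_div_iff₀ ha0]; linarith
    have h2 := rpow_one_add_le_one_add_mul_self h1 (p := s / 2) (by linarith [hs.1])
      (by linarith [hs.2])
    have h3 : a + (2 * i + z ^ 2) = a * (1 + (2 * i + z ^ 2) / a) := by field_simp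
    rw [h3, Real.mul_rpow ha0.le (by linarith), hg, Real.rpow_sub_one ha0.ne']
    calc _ ≤ a ^ (s / 2) * (1 + s / 2 * ((2 * i + z ^ 2) / a)) := by gcongr
      _ = _ := by field_simp
  unfold scaledDelta
  rw [inner_gradient_penalty, ← hi, ← ha, ← hg]
  unfold penalty
  rw [hadd, ← ha]
  unfold profile
  by_cases hz1 : z < 1
  · rw [if_pos hz1]
    unfold nearExp cutoff
    split_ifs with h1 h2
    · rw [Real.rpow_one]
      have : g * (2 * i + z ^ 2) ≤ g * (3 * z) := by gcongr; nlinarith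
      nlinarith
    · rw [indicator_of_mem ((mem_ball_zero_iff_div_lt_one hq y).2 hz1), Pi.one_apply,
        Real.rpow_two]
      nlinarith [sq_nonneg z]
    · rw [Real.rpow_two]
      nlinarith [sq_nonneg z]
  · rw [if_neg hz1]
    have hz1' := not_lt.1 hz1
    have hfar : (a + (2 * i + z ^ 2)) ^ (s / 2) ≤ a ^ (s / 2) + 3 * z ^ s := by
      calc (a + (2 * i + z ^ 2)) ^ (s / 2) ≤ (a + 3 * z ^ 2) ^ (s / 2) := by
            refine Real.rpow_le_rpow hpos.le ?_ (by linarith [hs.1])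
            nlinarith
        _ ≤ a ^ (s / 2) + (3 * z ^ 2) ^ (s / 2) :=
            Real.rpow_add_le_add_rpow ha0.le (by positivity) (by linarith [hs.1])
              (by linarith [hs.2])
        _ ≤ _ := by
            rw [Real.mul_rpow (by norm_num) (by positivity), ← Real.rpow_natCast,
              ← Real.rpow_mul hz0]
            have e1 : ((2 : ℕ) : ℝ) * (s / 2) = s := by push_cast; ring
            have e2 : (3 : ℝ) ^ (s / 2) ≤ 3 := by
              calc (3 : ℝ) ^ (s / 2) ≤ 3 ^ (1 : ℝ) :=
                    Real.rpow_le_rpow_of_exponent_le (by norm_num) (by linarith [hs.2])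
                _ = 3 := Real.rpow_one 3
            rw [e1]
            gcongr
    have hsf : z ^ s ≤ z ^ farExp s := Real.rpow_le_rpow_of_exponent_le hz1' (le_farExp hs)
    have hf0 : 0 ≤ z ^ farExp s := by positivity
    unfold cutoff
    split_ifs with h1 h2
    · linarith
    · rw [indicator_of_notMem (fun h => hz1 ((mem_ball_zero_iff_div_lt_one hq y).1 h))]
      linarith
    · rw [farExp_of_gt h1 h2, Real.rpow_one] at *
      have : -z ≤ g * (2 * i) := by nlinarith
      linarith

lemma exists_penalty_growth {s : ℝ} (hs : s ∈ Ioo (0 : ℝ) 1) (c : Space d) (q : ℝ)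
    (x : Space d) : ∃ C, ∀ y, |penalty s c q (x + y)| ≤ C * (1 + ‖y‖ ^ s) := by
  have hg0 : 0 ≤ s / 2 := by linarith [hs.1]
  have hg1 : s / 2 ≤ 1 := by linarith [hs.2]
  refine ⟨max ((1 + 2 * (‖x - c‖ ^ 2 / q ^ 2)) ^ (s / 2)) ((2 / q ^ 2) ^ (s / 2)), fun y => ?_⟩
  rw [abs_of_nonneg (penalty_nonneg hs.1.le c q _)]
  have h1 : quad c q (x + y) ≤ (1 + 2 * (‖x - c‖ ^ 2 / q ^ 2)) + (2 / q ^ 2) * ‖y‖ ^ 2 := by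
    unfold quad
    have h2 : ‖x + y - c‖ ^ 2 ≤ 2 * ‖x - c‖ ^ 2 + 2 * ‖y‖ ^ 2 := by
      have h3 : ‖x + y - c‖ ≤ ‖x - c‖ + ‖y‖ := by
        rw [add_sub_right_comm]; exact norm_add_le _ _
      nlinarith [norm_nonneg (x + y - c), sq_nonneg (‖x - c‖ - ‖y‖)]
    have h4 : ‖x + y - c‖ ^ 2 / q ^ 2 ≤ (2 * ‖x - c‖ ^ 2 + 2 * ‖y‖ ^ 2) / q ^ 2 := by gcongr
    have h5 : (2 * ‖x - c‖ ^ 2 + 2 * ‖y‖ ^ 2) / q ^ 2 =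
        2 * (‖x - c‖ ^ 2 / q ^ 2) + (2 / q ^ 2) * ‖y‖ ^ 2 := by ring
    linarith
  have h6 : (‖y‖ ^ 2) ^ (s / 2) = ‖y‖ ^ s := by
    rw [← Real.rpow_natCast, ← Real.rpow_mul (norm_nonneg y)]
    congr 1; push_cast; ring
  calc penalty s c q (x + y) ≤ quad c q (x + y) ^ (s / 2) := by unfold penalty; linarith
    _ ≤ ((1 + 2 * (‖x - c‖ ^ 2 / q ^ 2)) + (2 / q ^ 2) * ‖y‖ ^ 2) ^ (s / 2) :=
        Real.rpow_le_rpow (quad_pos c q _).le h1 hg0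
    _ ≤ (1 + 2 * (‖x - c‖ ^ 2 / q ^ 2)) ^ (s / 2) + ((2 / q ^ 2) * ‖y‖ ^ 2) ^ (s / 2) :=
        Real.rpow_add_le_add_rpow (by positivity) (by positivity) hg0 hg1
    _ = (1 + 2 * (‖x - c‖ ^ 2 / q ^ 2)) ^ (s / 2) + (2 / q ^ 2) ^ (s / 2) * ‖y‖ ^ s := by
        rw [Real.mul_rpow (by positivity) (by positivity), h6]
    _ ≤ _ := by
        rw [mul_add, mul_one]
        gcongr
        · exact le_max_left _ _
        · exact le_max_right _ _

/-! ### Invariance under sign change and addition of constants -/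

lemma gradient_fun_neg (g : Space d → ℝ) (x : Space d) :
    gradient (fun z => -g z) x = -gradient g x := by
  unfold gradient
  rw [fderiv_fun_neg, map_neg]

lemma gradient_fun_add_const (g : Space d → ℝ) (a : ℝ) (x : Space d) :
    gradient (fun z => g z + a) x = gradient g x := by
  unfold gradient
  rw [fderiv_add_const]

lemma delta_neg (s : ℝ) (w : Space d → ℝ) (x y : Space d) :
    delta s (fun z => -w z) x y = -delta s w x y := by
  rw [delta_eq_scaledDelta, delta_eq_scaledDelta]
  unfold scaledDelta
  rw [gradient_fun_neg, inner_neg_right]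
  ring

lemma delta_add_const (s a : ℝ) (w : Space d → ℝ) (x y : Space d) :
    delta s (fun z => w z + a) x y = delta s w x y := by
  rw [delta_eq_scaledDelta, delta_eq_scaledDelta]
  unfold scaledDelta
  rw [gradient_fun_add_const]
  ring

lemma IsC11On.neg {g : Space d → ℝ} {U : Set (Space d)} (hg : IsC11On g U) :
    IsC11On (fun x => -g x) U := by
  obtain ⟨h1, M, hM⟩ := hg
  refine ⟨h1.neg, M, ?_⟩
  have : gradient (fun x => -g x) = -gradient g := funext (gradient_fun_neg g)
  rw [this]
  exact hM.neg

lemma IsC11On.add_const {g : Space d → ℝ} {U : Set (Space d)} (hg : IsC11On g U) (a : ℝ) :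
    IsC11On (fun x => g x + a) U := by
  obtain ⟨h1, M, hM⟩ := hg
  refine ⟨h1.add_const a, M, ?_⟩
  have : gradient (fun x => g x + a) = gradient g := funext (gradient_fun_add_const g a)
  rwa [this]

lemma IsC11On.congr {g h : Space d → ℝ} {U : Set (Space d)} (hg : IsC11On g U) (hU : IsOpen U)
    (heq : ∀ x ∈ U, h x = g x) : IsC11On h U := by
  obtain ⟨h1, M, hM⟩ := hg
  refine ⟨h1.congr heq, M, fun x hx y hy => ?_⟩
  have hgr : ∀ z ∈ U, gradient h z = gradient g z := fun z hz =>
    Filter.EventuallyEq.gradient_eq (Filter.eventuallyEq_of_mem (hU.mem_nhds hz) heq)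
  rw [hgr x hx, hgr y hy]
  exact hM hx hy

/-- By linearity of the operator, lower bounds for supersolutions also bound `u` from above. -/
lemma IsViscositySubsolution.neg {s : ℝ} {K : Space d → Space d → ℝ → ℝ}
    {f u : Space d → ℝ → ℝ} {Ω : Set (Space d)} {I : Set ℝ}
    (h : IsViscositySubsolution (linearOperator s K) f Ω I u) :
    IsViscositySupersolution (linearOperator s K) (fun x t => -f x t) Ω I
      (fun x t => -u x t) where
  bounded := ⟨by simpa only [abs_neg] using h.bounded.1, fun t ht => (h.bounded.2 t ht).neg⟩
  semicontinuous := fun p hp a ha => by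
    filter_upwards [h.semicontinuous p hp (-a) (lt_neg_of_lt_neg ha)] with z hz
    exact lt_neg_of_lt_neg hz
  ge_of_touching := by
    intro x₀ hx₀ t₀ ht₀ ε hε hsub φ hφ hval hle
    have hφ' : IsTestFunction (fun x t => -φ x t) x₀ t₀ ε :=
      ⟨fun x hx t ht => (hφ.1 x hx t ht).neg, fun t ht => (hφ.2 t ht).neg⟩
    have key := h.le_of_touching x₀ hx₀ t₀ ht₀ ε hε hsub _ hφ' (by linarith)
      (fun p hp => by linarith [hle p hp])
    have hglue : glue (fun x t => -u x t) φ x₀ t₀ ε =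
        fun x t => -glue u (fun x t => -φ x t) x₀ t₀ ε x t := by
      funext x t; unfold glue; split_ifs <;> simp
    rw [hglue]
    have h1 : ∀ v : Space d → ℝ → ℝ,
        leftTimeDeriv (fun x t => -v x t) x₀ t₀ = -leftTimeDeriv v x₀ t₀ := fun v =>
      derivWithin.fun_neg
    have h2 : ∀ v : Space d → ℝ → ℝ,
        linearOperator s K (fun x t => -v x t) x₀ t₀ = -linearOperator s K v x₀ t₀ := by
      intro v
      unfold linearOperator
      simp_rw [delta_neg, neg_mul]
      exact integral_neg _
    rw [h1, h2]
    linarith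

lemma IsViscositySupersolution.add_const {s : ℝ} {K : Space d → Space d → ℝ → ℝ}
    {f u : Space d → ℝ → ℝ} {Ω : Set (Space d)} {I : Set ℝ}
    (h : IsViscositySupersolution (linearOperator s K) f Ω I u) (a : ℝ) :
    IsViscositySupersolution (linearOperator s K) f Ω I (fun x t => u x t + a) where
  bounded := by
    obtain ⟨M, hM⟩ := h.bounded.1
    exact ⟨⟨M + |a|, fun x t ht => (abs_add_le _ _).trans (by linarith [hM x t ht])⟩,
      fun t ht => (h.bounded.2 t ht).add_const a⟩
  semicontinuous := fun p hp b hb => by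
    filter_upwards [h.semicontinuous p hp (b - a) (sub_lt_iff_lt_add.2 hb)] with z hz
    exact sub_lt_iff_lt_add.1 hz
  ge_of_touching := by
    intro x₀ hx₀ t₀ ht₀ ε hε hsub φ hφ hval hle
    have hφ' : IsTestFunction (fun x t => φ x t + -a) x₀ t₀ ε :=
      ⟨fun x hx t ht => (hφ.1 x hx t ht).add_const _, fun t ht => (hφ.2 t ht).add_const _⟩
    have key := h.ge_of_touching x₀ hx₀ t₀ ht₀ ε hε hsub _ hφ' (by linarith)
      (fun p hp => by linarith [hle p hp])
    have hglue : glue (fun x t => u x t + a) φ x₀ t₀ ε =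
        fun x t => glue u (fun x t => φ x t + -a) x₀ t₀ ε x t + a := by
      funext x t; unfold glue; split_ifs <;> simp
    rw [hglue]
    have h1 : ∀ v : Space d → ℝ → ℝ,
        leftTimeDeriv (fun x t => v x t + a) x₀ t₀ = leftTimeDeriv v x₀ t₀ := fun v =>
      derivWithin_add_const a
    have h2 : ∀ v : Space d → ℝ → ℝ,
        linearOperator s K (fun x t => v x t + a) x₀ t₀ = linearOperator s K v x₀ t₀ := by
      intro v
      unfold linearOperator
      simp_rw [delta_add_const]
    rw [h1, h2]
    exact key

/-! ### The barrier and its comparison with a supersolution -/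

/-- Explicit solution of `m' = a g - b m`, `m(t₁) = 0`, with upper and lower bounds. -/
lemma exists_linear_ode {t₁ t₂ a b : ℝ} {g : ℝ → ℝ} (h12 : t₁ ≤ t₂)
    (hg : ContinuousOn g (Icc t₁ t₂)) (hg0 : ∀ t ∈ Icc t₁ t₂, 0 ≤ g t) (ha : 0 ≤ a) (hb : 0 ≤ b) :
    ∃ m : ℝ → ℝ, m t₁ = 0 ∧ (∀ t ∈ Icc t₁ t₂, HasDerivAt m (a * g t - b * m t) t) ∧
      (∀ t ∈ Icc t₁ t₂, 0 ≤ m t) ∧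
      (∀ G, (∀ t ∈ Icc t₁ t₂, g t ≤ G) → ∀ t ∈ Icc t₁ t₂, m t ≤ a * (G * (t₂ - t₁))) ∧
      ∀ t' t, t₁ ≤ t' → t' ≤ t → t ≤ t₂ →
        a * (Real.exp (-b * (t₂ - t₁)) * ∫ τ in t₁..t', g τ) ≤ m t := by
  -- Constant extension beyond the endpoints gives a continuous integrand on all of `ℝ`, hence
  -- two-sided derivatives of `m` also at `t₁` and `t₂`.
  set G₀ : ℝ → ℝ := IccExtend h12 (domRestrict (Icc t₁ t₂) g) with hG₀
  have hGc : Continuous G₀ := hg.domRestrict.Icc_extend'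
  have hGeq : ∀ t ∈ Icc t₁ t₂, G₀ t = g t := fun t ht => IccExtend_of_mem h12 _ ht
  have hG0 : ∀ t, 0 ≤ G₀ t := fun t => hg0 _ (projIcc t₁ t₂ h12 t).2
  set J : ℝ → ℝ := fun t => ∫ τ in t₁..t, Real.exp (b * τ) * G₀ τ with hJ
  have hcont : Continuous fun τ => Real.exp (b * τ) * G₀ τ := by fun_prop
  have hJd : ∀ t, HasDerivAt J (Real.exp (b * t) * G₀ t) t := fun t =>
    intervalIntegral.integral_hasDerivAt_right (hcont.intervalIntegrable _ _)
      (hcont.stronglyMeasurableAtFilter _ _) hcont.continuousAt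
  have hJ0 : ∀ t, t₁ ≤ t → 0 ≤ J t := fun t ht =>
    intervalIntegral.integral_nonneg ht fun τ _ => mul_nonneg (Real.exp_pos _).le (hG0 τ)
  -- Variation of constants. The lower bound keeps only the mass collected before `t'` and damps it
  -- by the worst factor `exp (-b (t₂ - t₁))`.
  refine ⟨fun t => a * (Real.exp (-b * t) * J t), ?_, ?_, ?_, ?_, ?_⟩
  · simp [hJ]
  · intro t ht
    have he : HasDerivAt (fun t => Real.exp (-b * t)) (Real.exp (-b * t) * -b) t := by
      simpa using ((hasDerivAt_id t).const_mul (-b)).exp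
    have h := (he.mul (hJd t)).const_mul a
    refine h.congr_deriv ?_
    have h1 : Real.exp (-b * t) * (Real.exp (b * t) * G₀ t) = g t := by
      rw [← mul_assoc, ← Real.exp_add, hGeq t ht]; simp
    linear_combination a * h1
  · intro t ht
    have := hJ0 t ht.1
    positivity
  · intro G hGle t ht
    have hGnn : 0 ≤ G := (hg0 t ht).trans (hGle t ht)
    have h1 : J t ≤ ∫ τ in t₁..t, Real.exp (b * t) * G := by
      refine intervalIntegral.integral_mono_on ht.1 (hcont.intervalIntegrable _ _)
        (by simp) fun τ hτ => ?_
      have h2 : G₀ τ ≤ G := hGle _ (projIcc t₁ t₂ h12 τ).2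
      have h3 : Real.exp (b * τ) ≤ Real.exp (b * t) :=
        Real.exp_le_exp.2 (mul_le_mul_of_nonneg_left hτ.2 hb)
      exact mul_le_mul h3 h2 (hG0 τ) (Real.exp_pos _).le
    rw [intervalIntegral.integral_const, smul_eq_mul] at h1
    have h4 : Real.exp (-b * t) * J t ≤ G * (t₂ - t₁) := by
      calc Real.exp (-b * t) * J t
          ≤ Real.exp (-b * t) * ((t - t₁) * (Real.exp (b * t) * G)) := by gcongr
        _ = (Real.exp (-b * t) * Real.exp (b * t)) * (G * (t - t₁)) := by ring
        _ = G * (t - t₁) := by rw [← Real.exp_add]; simp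
        _ ≤ _ := by gcongr; exact ht.2
    exact mul_le_mul_of_nonneg_left h4 ha
  · intro t' t h1 h2 h3
    refine mul_le_mul_of_nonneg_left ?_ ha
    have e1 : ∫ τ in t₁..t', g τ = ∫ τ in t₁..t', G₀ τ := by
      refine intervalIntegral.integral_congr fun τ hτ => ?_
      rw [uIcc_of_le h1] at hτ
      exact (hGeq τ ⟨hτ.1, hτ.2.trans (h2.trans h3)⟩).symm
    have e2 : ∫ τ in t₁..t', Real.exp (b * t₁) * G₀ τ ≤ J t' := by
      refine intervalIntegral.integral_mono_on h1 ((hGc.const_mul _).intervalIntegrable _ _)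
        (hcont.intervalIntegrable _ _) fun τ hτ => ?_
      exact mul_le_mul_of_nonneg_right
        (Real.exp_le_exp.2 (mul_le_mul_of_nonneg_left hτ.1 hb)) (hG0 τ)
    have e3 : J t' ≤ J t := by
      have : J t = J t' + ∫ τ in t'..t, Real.exp (b * τ) * G₀ τ :=
        (intervalIntegral.integral_add_adjacent_intervals (hcont.intervalIntegrable _ _)
          (hcont.intervalIntegrable _ _)).symm
      have h4 : 0 ≤ ∫ τ in t'..t, Real.exp (b * τ) * G₀ τ :=
        intervalIntegral.integral_nonneg h2 fun τ _ => mul_nonneg (Real.exp_pos _).le (hG0 τ)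
      linarith
    rw [intervalIntegral.integral_const_mul, ← e1] at e2
    have h0 : 0 ≤ ∫ τ in t₁..t', g τ := by
      rw [e1]; exact intervalIntegral.integral_nonneg h1 fun τ _ => hG0 τ
    calc Real.exp (-b * (t₂ - t₁)) * ∫ τ in t₁..t', g τ
        = Real.exp (-b * t₂) * (Real.exp (b * t₁) * ∫ τ in t₁..t', g τ) := by
          rw [← mul_assoc, ← Real.exp_add]; ring_nf
      _ ≤ Real.exp (-b * t) * (Real.exp (b * t₁) * ∫ τ in t₁..t', g τ) := by
          refine mul_le_mul_of_nonneg_right (Real.exp_le_exp.2 ?_) (by positivity)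
          nlinarith
      _ ≤ Real.exp (-b * t) * J t := by
          gcongr
          exact e2.trans e3

/-- Spatial part of the barrier computation: a function `v` touched from below at `x₀` by
`a * bump - A * penalty - b`, with the gain coming from the mass of `v` on a ball. -/
lemma IsLevyDensity.le_integral_delta_of_touching {s Lam ℓ N r a A b τ ε Mv : ℝ}
    {k v w : Space d → ℝ} {c x₀ : Space d} (hd : 1 ≤ d) (hs : s ∈ Ioo (0 : ℝ) 1)
    (hk : IsLevyDensity s Lam k) (hr : 0 < r) (hN : 0 < N) (hℓ : 0 ≤ ℓ)
    (hlow : ∀ y, y ≠ 0 → ‖y‖ ≤ (N + 1) * r → ℓ ≤ k y)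
    (ha : 0 ≤ a) (hA : 0 ≤ A) (hε : 0 < ε) (hx₀ : ‖x₀ - c‖ ≤ N * r)
    (hv : AEMeasurable v) (hvb : ∀ x, |v x| ≤ Mv)
    (hloc : ∀ x ∈ ball x₀ ε, v x = a * bump c r x - A * penalty s c (N * r) x - b)
    (hglob : ∀ x, a * bump c r x - A * penalty s c (N * r) x - b ≤ v x)
    (hw : IntegrableOn w (ball c r))
    (hgain : ∀ x ∈ ball c r,
      w x - (a + τ) ≤ v x - (a * bump c r x - A * penalty s c (N * r) x - b)) :
    -(a * bump c r x₀ * (2 * (Lam * profileIntegral d s * r ^ (-2 * s)))) -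
        A * (4 * (Lam * profileIntegral d s * (N * r) ^ (-2 * s))) +
        ℓ * bump c r x₀ * ((∫ x in ball c r, w x) - (a + τ) * volume.real (ball c r)) ≤
      ∫ y, delta s v x₀ y * k y := by
  have hq : 0 < N * r := mul_pos hN hr
  set β := bump c r with hβ
  set P := penalty s c (N * r) with hP
  have hβc : ContDiff ℝ 2 β := contDiff_bump c r
  have hPc : ContDiff ℝ 2 P := contDiff_penalty s c (N * r)
  set Φ : Space d → ℝ := fun x => a * β x - A * P x - b with hΦ
  have hΦc : ContDiff ℝ 2 Φ := ((contDiff_const.mul hβc).sub (contDiff_const.mul hPc)).sub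
    contDiff_const
  have hgrow1 : ∀ {g : Space d → ℝ} {M : ℝ}, (∀ x, |g x| ≤ M) →
      ∀ y, |g (x₀ + y)| ≤ M * (1 + ‖y‖ ^ s) := by
    intro g M hM y
    have h0 : 0 ≤ M := (abs_nonneg _).trans (hM 0)
    have h1 : 0 ≤ ‖y‖ ^ s := by positivity
    nlinarith [hM (x₀ + y)]
  have Iv : Integrable fun y => delta s v x₀ y * k y :=
    hk.integrable_delta hd hs hv hε ((hΦc.isC11On_ball x₀ ε).congr isOpen_ball hloc) (hgrow1 hvb)
  have Iβ : Integrable fun y => delta s β x₀ y * k y := by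
    refine hk.integrable_delta hd hs hβc.continuous.aemeasurable one_pos
      (hβc.isC11On_ball x₀ 1) (hgrow1 (M := 1) fun x => ?_)
    rw [abs_of_pos (bump_pos c r x)]
    exact bump_le_one c r x
  have IP : Integrable fun y => delta s P x₀ y * k y := by
    obtain ⟨C, hC⟩ := exists_penalty_growth hs c (N * r) x₀
    exact hk.integrable_delta hd hs hPc.continuous.aemeasurable one_pos
      (hPc.isC11On_ball x₀ 1) hC
  have hgrad : gradient v x₀ = a • gradient β x₀ - A • gradient P x₀ := by
    have h1 : gradient v x₀ = gradient Φ x₀ := Filter.EventuallyEq.gradient_eq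
      (Filter.eventuallyEq_of_mem (isOpen_ball.mem_nhds (mem_ball_self hε)) hloc)
    have hdβ := (hβc.differentiable (by norm_num) x₀).hasFDerivAt
    have hdP := (hPc.differentiable (by norm_num) x₀).hasFDerivAt
    have h2 : fderiv ℝ Φ x₀ = a • fderiv ℝ β x₀ - A • fderiv ℝ P x₀ :=
      (((hdβ.const_mul a).sub (hdP.const_mul A)).sub_const b).fderiv
    rw [h1]
    unfold gradient
    rw [h2, map_sub, map_smulₛₗ, map_smulₛₗ]
    simp
  have hx₀v : v x₀ = Φ x₀ := hloc x₀ (mem_ball_self hε)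
  -- Near `x₀` the functions `v` and `Φ` coincide, so they share value and gradient at `x₀`, and the
  -- correction terms cancel exactly.
  have hsplit : ∀ y, delta s v x₀ y * k y = a * (delta s β x₀ y * k y) -
      A * (delta s P x₀ y * k y) + (v (x₀ + y) - Φ (x₀ + y)) * k y := by
    intro y
    simp only [delta_eq_scaledDelta, scaledDelta, hgrad, hx₀v, inner_sub_right, inner_smul_right,
      hΦ]
    ring
  have ID : Integrable fun y => (v (x₀ + y) - Φ (x₀ + y)) * k y := by
    have h := Iv.sub ((Iβ.const_mul a).sub (IP.const_mul A))
    refine h.congr (Eventually.of_forall fun y => ?_)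
    simp only [Pi.sub_apply, hsplit y]
    ring
  have hsum : ∫ y, delta s v x₀ y * k y = a * (∫ y, delta s β x₀ y * k y) -
      A * (∫ y, delta s P x₀ y * k y) + ∫ y, (v (x₀ + y) - Φ (x₀ + y)) * k y := by
    have IS : Integrable fun y => a * (delta s β x₀ y * k y) - A * (delta s P x₀ y * k y) :=
      (Iβ.const_mul a).sub (IP.const_mul A)
    simp_rw [hsplit]
    rw [integral_add IS ID,
      integral_sub (Iβ.const_mul a) (IP.const_mul A), integral_const_mul, integral_const_mul]
  have hB := hk.le_integral_delta (c := 2 * β x₀) hd hs hr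
    (by have := (bump_pos c r x₀).le; positivity) Iβ (scaledDelta_bump_ge hs hr c x₀)
  have hPen : ∫ y, delta s P x₀ y * k y ≤
      4 * (Lam * profileIntegral d s * (N * r) ^ (-2 * s)) := by
    have hneg : ∀ y, delta s (fun x => -P x) x₀ y * k y = -(delta s P x₀ y * k y) := fun y => by
      rw [delta_neg, neg_mul]
    have IP' : Integrable fun y => delta s (fun x => -P x) x₀ y * k y := by
      simp_rw [hneg]; exact IP.neg
    have h := hk.le_integral_delta (c := 4) hd hs hq (by norm_num) IP' (fun y => by
      have h1 := scaledDelta_penalty_le hs hq hx₀ y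
      unfold scaledDelta at h1 ⊢
      rw [gradient_fun_neg, inner_neg_right]
      linarith)
    simp_rw [hneg] at h
    rw [integral_neg] at h
    linarith
  -- Since `v - Φ ≥ 0`, everything outside the ball may be dropped and a factor `β x₀ ≤ 1` inserted.
  -- That factor is given away on purpose: the time derivative of the barrier carries the same one.
  have hGain : ℓ * β x₀ * ((∫ x in ball c r, w x) - (a + τ) * volume.real (ball c r)) ≤
      ∫ y, (v (x₀ + y) - Φ (x₀ + y)) * k y := by
    set g : Space d → ℝ := (ball c r).indicator fun x => ℓ * β x₀ * (w x - (a + τ)) with hg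
    have hconst : IntegrableOn (fun _ : Space d => a + τ) (ball c r) :=
      integrableOn_const (measure_ball_lt_top.ne)
    have hgo : IntegrableOn (fun x => ℓ * β x₀ * (w x - (a + τ))) (ball c r) :=
      (hw.sub hconst).const_mul _
    have hgi : Integrable g := hgo.integrable_indicator measurableSet_ball
    have e1 : ∫ y, g (x₀ + y) =
        ℓ * β x₀ * ((∫ x in ball c r, w x) - (a + τ) * volume.real (ball c r)) := by
      rw [integral_add_left_eq_self g x₀, hg, integral_indicator measurableSet_ball,
        integral_const_mul, integral_sub hw hconst, setIntegral_const, smul_eq_mul]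
      ring
    rw [← e1]
    refine integral_mono_ae (hgi.comp_add_left x₀) ID ?_
    filter_upwards [ae_ne_zero hd] with y hy
    have hnn : 0 ≤ v (x₀ + y) - Φ (x₀ + y) := sub_nonneg.2 (hglob _)
    by_cases hmem : x₀ + y ∈ ball c r
    · simp only [hg, indicator_of_mem hmem]
      have h1 := hgain _ hmem
      have h2 : ‖y‖ ≤ (N + 1) * r := by
        have h3 : ‖x₀ + y - c‖ < r := mem_ball_iff_norm.1 hmem
        have h4 : y = (x₀ + y - c) - (x₀ - c) := by abel
        calc ‖y‖ = ‖(x₀ + y - c) - (x₀ - c)‖ := by rw [← h4]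
          _ ≤ ‖x₀ + y - c‖ + ‖x₀ - c‖ := norm_sub_le _ _
          _ ≤ _ := by linarith
      have h5 := hlow y hy h2
      have hb0 := (bump_pos c r x₀).le
      have hb1 := bump_le_one c r x₀
      set D := v (x₀ + y) - Φ (x₀ + y)
      calc ℓ * β x₀ * (w (x₀ + y) - (a + τ)) ≤ ℓ * β x₀ * D := by
            refine mul_le_mul_of_nonneg_left h1 (mul_nonneg hℓ hb0)
        _ ≤ ℓ * 1 * D := by gcongr
        _ ≤ D * k y := by rw [mul_one, mul_comm]; gcongr
    · simp only [hg, indicator_of_notMem hmem]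
      exact mul_nonneg hnn (hk.nonneg y hy)
  rw [hsum]
  have h1 := mul_le_mul_of_nonneg_left hB ha
  have h2 := mul_le_mul_of_nonneg_left hPen hA
  linarith

lemma IsAdmissibleKernel.isLevyDensity {s lam Lam ρ R : ℝ} {K : Space d → Space d → ℝ → ℝ}
    (hK : IsAdmissibleKernel s lam Lam ρ R K) (hlam : 0 ≤ lam) (hρ : 0 ≤ ρ) {x : Space d} {t : ℝ}
    (hx : x ∈ ball (0 : Space d) R) (ht : t ∈ timeInterval s R) :
    IsLevyDensity s Lam (fun y => K x y t) where
  aemeasurable := hK.measurable x hx t ht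
  nonneg y hy := le_trans (by positivity) (hK.lower x hx t ht y hy)
  upper := hK.upper x hx t ht
  symmetric h y := hK.symmetric h x hx t ht y

/-- The truncation at `ρ` is invisible at every scale `q ≥ ρ`: both entries of the minimum are at
least `q ^ (-d - 2s)`. -/
lemma IsAdmissibleKernel.lower_of_norm_le {s lam Lam ρ R q : ℝ}
    {K : Space d → Space d → ℝ → ℝ}
    (hK : IsAdmissibleKernel s lam Lam ρ R K) (hs : 0 ≤ s) (hlam : 0 ≤ lam) (hρ : 0 < ρ)
    (hρq : ρ ≤ q) {x : Space d} {t : ℝ}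
    (hx : x ∈ ball (0 : Space d) R) (ht : t ∈ timeInterval s R) {y : Space d} (hy : y ≠ 0)
    (hyq : ‖y‖ ≤ q) : lam * q ^ (-(d : ℝ) - 2 * s) ≤ K x y t := by
  refine le_trans (mul_le_mul_of_nonneg_left (le_min ?_ ?_) hlam) (hK.lower x hx t ht y hy)
  · exact Real.rpow_le_rpow_of_nonpos (norm_pos_iff.2 hy) hyq
      (by linarith [(Nat.cast_nonneg d : (0 : ℝ) ≤ d)])
  · exact Real.rpow_le_rpow_of_nonpos hρ hρq
      (by linarith [(Nat.cast_nonneg d : (0 : ℝ) ≤ d)])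

lemma penalty_le {s : ℝ} (hs : s ∈ Ioo (0 : ℝ) 1) (c : Space d) (q : ℝ) (x : Space d) :
    penalty s c q x ≤ ‖x - c‖ ^ 2 / q ^ 2 := by
  have h0 : 0 ≤ ‖x - c‖ ^ 2 / q ^ 2 := by positivity
  have h := rpow_one_add_le_one_add_mul_self (s := ‖x - c‖ ^ 2 / q ^ 2) (by linarith)
    (p := s / 2) (by linarith [hs.1]) (by linarith [hs.2])
  unfold penalty quad
  nlinarith [hs.2]

/-- Here `quad ≥ 2`, so the subtracted `1` is at most the fraction `2 ^ (-(s/2))` of `quad ^ (s/2)`.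
-/
lemma le_penalty {s q : ℝ} (hs : s ∈ Ioo (0 : ℝ) 1) (hq : 0 < q) {c x : Space d}
    (hx : q ≤ ‖x - c‖) :
    (1 - 2 ^ (-(s / 2))) * (‖x - c‖ / q) ^ s ≤ penalty s c q x := by
  have hs2 : 0 < s / 2 := by linarith [hs.1]
  set X := ‖x - c‖ / q with hX
  have hX1 : 1 ≤ X := (one_le_div hq).2 hx
  have hquad : quad c q x = 1 + X ^ 2 := by rw [hX, div_pow]; rfl
  unfold penalty
  rw [hquad]
  have h1 : X ^ s ≤ (1 + X ^ 2) ^ (s / 2) := by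
    have : X ^ s = (X ^ 2) ^ (s / 2) := by
      rw [← Real.rpow_natCast, ← Real.rpow_mul (by linarith)]
      congr 1; push_cast; ring
    rw [this]
    exact Real.rpow_le_rpow (by positivity) (by linarith) hs2.le
  have h2 : 1 ≤ 2 ^ (-(s / 2)) * (1 + X ^ 2) ^ (s / 2) := by
    rw [Real.rpow_neg (by norm_num), ← div_eq_inv_mul, one_le_div (by positivity)]
    exact Real.rpow_le_rpow (by norm_num) (by nlinarith) hs2.le
  have h3 : (2 : ℝ) ^ (-(s / 2)) ≤ 1 :=
    Real.rpow_le_one_of_one_le_of_nonpos (by norm_num) (by linarith)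
  nlinarith

/-- The constant `ℓ` in the lower bound `K ≥ ℓ` at distance at most `(N + 1) r`. -/
def lowerConst (d : ℕ) (s lam N r : ℝ) : ℝ := lam * ((N + 1) * r) ^ (-(d : ℝ) - 2 * s)

/-- The decay rate in the differential equation for the barrier height. -/
def decayRate (s lam Lam N r : ℝ) (c : Space d) : ℝ :=
  2 * (Lam * profileIntegral d s * r ^ (-2 * s)) + lowerConst d s lam N r * volume.real (ball c r)

/-- A supersolution that is above the barrier initially and outside a ball
stays above it. -/
theorem barrier_le {s lam Lam ρ R F N r t₁ t₂ A η : ℝ} {K : Space d → Space d → ℝ → ℝ}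
    {f w : Space d → ℝ → ℝ} {c : Space d} {m : ℝ → ℝ} (hd : 1 ≤ d) (hs : s ∈ Ioo (0 : ℝ) 1)
    (hlam : 0 ≤ lam) (hρ : 0 < ρ) (hK : IsAdmissibleKernel s lam Lam ρ R K)
    (hw : IsViscositySupersolution (linearOperator s K) f (ball 0 R) (timeInterval s R) w)
    (hcont : ContinuousOn (fun p : Space d × ℝ => w p.1 p.2) (ball 0 R ×ˢ timeInterval s R))
    (hf : ∀ x ∈ ball (0 : Space d) R, ∀ t ∈ timeInterval s R, -F ≤ f x t)
    (hr : 0 < r) (hN : 0 < N) (hball : closedBall c (N * r) ⊆ ball 0 R)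
    (hρr : ρ ≤ (N + 1) * r) (hI : Icc t₁ t₂ ⊆ timeInterval s R) (hA : 0 ≤ A) (hm0 : m t₁ = 0)
    (hmnn : ∀ t ∈ Icc t₁ t₂, 0 ≤ m t)
    (hm : ∀ t ∈ Icc t₁ t₂, HasDerivAt m (lowerConst d s lam N r * (∫ x in ball c r, w x t) -
      decayRate s lam Lam N r c * m t) t)
    (hη0 : 0 ≤ η)
    (hη : F + A * (4 * (Lam * profileIntegral d s * (N * r) ^ (-2 * s))) < η)
    (hlow : ∀ t ∈ Icc t₁ t₂, ∀ x, -(A * penalty s c (N * r) x) ≤ w x t)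
    (hout : ∀ t ∈ Icc t₁ t₂, ∀ x, N * r ≤ ‖x - c‖ →
      m t * bump c r x - A * penalty s c (N * r) x ≤ w x t)
    {x : Space d} {t : ℝ} (hx : x ∈ closedBall c (N * r)) (ht : t ∈ Icc t₁ t₂) :
    m t * bump c r x - A * penalty s c (N * r) x - η * (t - t₁) ≤ w x t := by
  by_contra! hcontra
  have hq : 0 < N * r := mul_pos hN hr
  set β := bump c r with hβ
  set P := penalty s c (N * r) with hP
  set ℓ := lowerConst d s lam N r with hℓ
  have hβc : ContDiff ℝ 2 β := contDiff_bump c r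
  have hPc : ContDiff ℝ 2 P := contDiff_penalty s c (N * r)
  have hℓ0 : 0 ≤ ℓ := by rw [hℓ]; unfold lowerConst; positivity
  set J : Space d × ℝ → ℝ := fun p =>
    w p.1 p.2 - m p.2 * β p.1 + A * P p.1 + η * (p.2 - t₁) with hJ
  set S := closedBall c (N * r) ×ˢ Icc t₁ t₂ with hS
  have hmc : ContinuousOn m (Icc t₁ t₂) := fun t ht => (hm t ht).continuousAt.continuousWithinAt
  have hJc : ContinuousOn J S := by
    have h1 : ContinuousOn (fun p : Space d × ℝ => w p.1 p.2) S :=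
      hcont.mono (prod_mono hball hI)
    have h2 : ContinuousOn (fun p : Space d × ℝ => m p.2) S :=
      hmc.comp continuousOn_snd fun p hp => hp.2
    have h3 : Continuous fun p : Space d × ℝ => β p.1 := hβc.continuous.comp continuous_fst
    have h4 : Continuous fun p : Space d × ℝ => P p.1 := hPc.continuous.comp continuous_fst
    exact ((h1.sub (h2.mul h3.continuousOn)).add (h4.const_mul A).continuousOn).add
      (by fun_prop)
  obtain ⟨⟨x₀, t₀⟩, ⟨hx₀, ht₀⟩, hmin⟩ := ((isCompact_closedBall c (N * r)).prod
    (isCompact_Icc (a := t₁) (b := t₂))).exists_isMinOn ⟨(x, t), hx, ht⟩ hJc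
  simp only at hx₀ ht₀
  -- The barrier lowered by `h` touches `w` from below at `(x₀, t₀)`. This point is neither initial,
  -- as `m t₁ = 0`, nor on the lateral boundary, by `hout`.
  set h := -J (x₀, t₀) with hh
  have hh0 : 0 < h := by
    have h1 : J (x₀, t₀) ≤ J (x, t) := hmin (show (x, t) ∈ S from ⟨hx, ht⟩)
    have h2 : J (x, t) < 0 := by simp only [hJ]; linarith
    linarith
  have hall : ∀ t ∈ Icc t₁ t₂, ∀ x,
      m t * β x - A * P x - η * (t - t₁) - h ≤ w x t := by
    intro t ht x
    by_cases hx : x ∈ closedBall c (N * r)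
    · have h1 : J (x₀, t₀) ≤ J (x, t) := hmin (show (x, t) ∈ S from ⟨hx, ht⟩)
      have h2 : J (x, t) = w x t - m t * β x + A * P x + η * (t - t₁) := rfl
      linarith
    · have h1 : N * r ≤ ‖x - c‖ := by
        rw [mem_closedBall_iff_norm, not_le] at hx; exact hx.le
      have h2 := hout t ht x h1
      have h3 := mul_nonneg hη0 (sub_nonneg.2 ht.1)
      linarith
  have hJ0 : w x₀ t₀ = m t₀ * β x₀ - A * P x₀ - η * (t₀ - t₁) - h := by
    simp only [hh, hJ]; ring
  have ht₀1 : t₁ < t₀ := by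
    refine lt_of_le_of_ne ht₀.1 fun heq => ?_
    have h1 := hlow t₀ ht₀ x₀
    rw [hJ0, ← heq, hm0] at h1
    linarith
  have hx₀1 : x₀ ∈ ball c (N * r) := by
    rw [mem_ball_iff_norm]
    by_contra! hge
    have h1 := hout t₀ ht₀ x₀ hge
    have h3 := mul_nonneg hη0 (sub_nonneg.2 ht₀.1)
    rw [hJ0] at h1
    linarith
  set V := volume.real (ball c r) with hV
  have hV0 : 0 ≤ V := measureReal_nonneg
  set gap := η - (F + A * (4 * (Lam * profileIntegral d s * (N * r) ^ (-2 * s)))) with hgap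
  have hgap0 : 0 < gap := sub_pos.2 hη
  -- Gluing the test function in near `x₀` lowers `w` there. With `ε` so small that the drop at time
  -- `t₀` is at most `τ`, the lost gain is at most `ℓ V τ`, less than the slack in `η`.
  set τ := gap / (2 * (ℓ * V + 1)) with hτ
  have hτ0 : 0 < τ := by positivity
  have hτV : ℓ * V * τ < gap := by
    have h1 : (2 * (ℓ * V + 1)) * τ = gap := by
      rw [hτ]; exact mul_div_cancel₀ _ (by positivity)
    have h2 : 0 ≤ ℓ * V * τ := by positivity
    nlinarith
  obtain ⟨ε, hε, hε1, hε2, hε3⟩ : ∃ ε > 0, ball x₀ ε ⊆ ball c (N * r) ∧ t₁ ≤ t₀ - ε ∧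
      ∀ x ∈ ball x₀ ε, J (x, t₀) + h ≤ τ := by
    have hslice : ContinuousAt (fun x => J (x, t₀)) x₀ := by
      have h1 : ContinuousOn (fun x => J (x, t₀)) (closedBall c (N * r)) :=
        hJc.comp (by fun_prop) fun x hx => ⟨hx, ht₀⟩
      exact h1.continuousAt (mem_of_superset (isOpen_ball.mem_nhds hx₀1) ball_subset_closedBall)
    have h2 : ∀ᶠ x in 𝓝 x₀, J (x, t₀) < τ - h :=
      hslice.eventually_lt continuousAt_const (by linarith)
    obtain ⟨ε₁, hε₁, hb⟩ := Metric.eventually_nhds_iff_ball.1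
      (h2.and (isOpen_ball.mem_nhds hx₀1))
    refine ⟨min ε₁ (t₀ - t₁), lt_min hε₁ (sub_pos.2 ht₀1), fun x hx => ?_, ?_, fun x hx => ?_⟩
    · exact (hb x (ball_subset_ball (min_le_left _ _) hx)).2
    · linarith [min_le_right ε₁ (t₀ - t₁)]
    · linarith [(hb x (ball_subset_ball (min_le_left _ _) hx)).1]
  have htime : Ioc (t₀ - ε) t₀ ⊆ Icc t₁ t₂ := fun t ht =>
    ⟨hε2.trans ht.1.le, ht.2.trans ht₀.2⟩
  have hspace : ball x₀ ε ⊆ ball 0 R := hε1.trans (ball_subset_closedBall.trans hball)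
  have hx₀R : x₀ ∈ ball (0 : Space d) R := hball hx₀
  have ht₀R : t₀ ∈ timeInterval s R := hI ht₀
  have ht₀ε : t₀ ∈ Ioc (t₀ - ε) t₀ := ⟨by linarith, le_rfl⟩
  set φ : Space d → ℝ → ℝ := fun x t => m t * β x - A * P x - η * (t - t₁) - h with hφ
  have htest : IsTestFunction φ x₀ t₀ ε := by
    refine ⟨fun x _ t ht => ?_, fun t _ => ?_⟩
    · have := (hm t (htime ht)).differentiableAt
      exact DifferentiableAt.differentiableWithinAt (by fun_prop)
    · refine ContDiff.isC11On_ball ?_ x₀ ε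
      exact (((contDiff_const.mul hβc).sub (contDiff_const.mul hPc)).sub contDiff_const).sub
        contDiff_const
  have key := hw.ge_of_touching x₀ hx₀R t₀ ht₀R ε hε
    (prod_mono hspace (htime.trans hI)) φ htest hJ0 (fun p hp => hall p.2 (htime hp.2) p.1)
  set v := glue w φ x₀ t₀ ε with hv
  have hvin : ∀ x ∈ ball x₀ ε, ∀ t ∈ Ioc (t₀ - ε) t₀, v x t = φ x t := fun x hx t ht =>
    if_pos ⟨hx, ht⟩
  have hvout : ∀ x ∉ ball x₀ ε, v x t₀ = w x t₀ := fun x hx => if_neg fun h => hx h.1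
  have hderiv : leftTimeDeriv v x₀ t₀ =
      (ℓ * (∫ x in ball c r, w x t₀) - decayRate s lam Lam N r c * m t₀) * β x₀ - η := by
    have h1 : HasDerivAt (φ x₀) ((ℓ * (∫ x in ball c r, w x t₀) -
        decayRate s lam Lam N r c * m t₀) * β x₀ - η) t₀ := by
      have h2 := ((((hm t₀ ht₀).mul_const (β x₀)).sub_const (A * P x₀)).sub
        (((hasDerivAt_id t₀).sub_const t₁).const_mul η)).sub_const h
      exact h2.congr_deriv (by ring)
    have h3 : v x₀ =ᶠ[𝓝[Iic t₀] t₀] φ x₀ := by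
      have h4 : Ioc (t₀ - ε) t₀ ∈ 𝓝[Iic t₀] t₀ := Ioc_mem_nhdsLE (by linarith)
      exact Filter.eventuallyEq_of_mem h4 (hvin x₀ (mem_ball_self hε))
    exact (h1.hasDerivWithinAt.congr_of_eventuallyEq h3
      (hvin x₀ (mem_ball_self hε) t₀ ht₀ε)).derivWithin (uniqueDiffWithinAt_Iic t₀)
  obtain ⟨M, hM⟩ := hw.bounded.1
  have hMt : ∀ x, |w x t₀| ≤ M := fun x => hM x t₀ ht₀R
  have hηt : 0 ≤ η * (t₀ - t₁) := mul_nonneg hη0 (sub_nonneg.2 ht₀.1)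
  have hm₀ := hmnn t₀ ht₀
  have hPnn : ∀ x, 0 ≤ A * P x := fun x => mul_nonneg hA (penalty_nonneg hs.1.le c _ x)
  have hmβ : ∀ x, 0 ≤ m t₀ * β x := fun x => mul_nonneg hm₀ (bump_pos c r x).le
  have hmβ1 : ∀ x, m t₀ * β x ≤ m t₀ := fun x => mul_le_of_le_one_right hm₀ (bump_le_one c r x)
  have hL := (hK.isLevyDensity hlam hρ.le hx₀R ht₀R).le_integral_delta_of_touching
    (ℓ := ℓ) (N := N) (r := r) (a := m t₀) (A := A) (b := η * (t₀ - t₁) + h) (τ := τ) (ε := ε)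
    (Mv := M + A + (η * (t₀ - t₁) + h)) (v := fun x => v x t₀) (w := fun x => w x t₀) (c := c)
    (x₀ := x₀) hd hs hr hN hℓ0
    (fun y hy hyn => hK.lower_of_norm_le hs.1.le hlam hρ hρr hx₀R ht₀R hy hyn) hm₀ hA hε
    (mem_closedBall_iff_norm.1 hx₀)
    (by
      have h1 : (fun x => v x t₀) = fun x => (ball x₀ ε).indicator (fun x => φ x t₀) x +
          (ball x₀ ε)ᶜ.indicator (fun x => w x t₀) x := by
        funext x
        by_cases hx : x ∈ ball x₀ ε
        · rw [hvin x hx t₀ ht₀ε, indicator_of_mem hx, indicator_of_notMem (not_not.2 hx), add_zero]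
        · rw [hvout x hx, indicator_of_notMem hx, indicator_of_mem (mem_compl hx), zero_add]
      rw [h1]
      have h2 : Continuous fun x => φ x t₀ := by
        have := hβc.continuous
        have := hPc.continuous
        fun_prop
      exact (h2.aemeasurable.indicator measurableSet_ball).add
        ((hw.bounded.2 t₀ ht₀R).indicator measurableSet_ball.compl))
    (by
      intro x
      have h1 := abs_le.1 (hMt x)
      have h2 : 0 ≤ M := (abs_nonneg _).trans (hMt x)
      by_cases hx : x ∈ ball x₀ ε
      · rw [hvin x hx t₀ ht₀ε, abs_le]
        have h3 : φ x t₀ ≤ w x t₀ := hall t₀ ht₀ x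
        have h4 : A * P x ≤ A := by
          refine mul_le_of_le_one_right hA ((penalty_le hs c _ x).trans ?_)
          have h5 := mem_ball_iff_norm.1 (hε1 hx)
          rw [div_le_one (by positivity)]
          gcongr
        have h6 := hmβ x
        refine ⟨?_, by linarith⟩
        simp only [hφ]
        linarith
      · rw [hvout x hx, abs_le]
        constructor <;> linarith)
    (by
      intro x hx
      rw [hvin x hx t₀ ht₀ε]
      simp only [hφ]
      ring)
    (by
      intro x
      by_cases hx : x ∈ ball x₀ ε
      · rw [hvin x hx t₀ ht₀ε]
        simp only [hφ]
        exact le_of_eq (by ring)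
      · rw [hvout x hx]
        have := hall t₀ ht₀ x
        linarith)
    (Measure.integrableOn_of_bounded (M := M) measure_ball_lt_top.ne
      (hw.bounded.2 t₀ ht₀R).aestronglyMeasurable (Eventually.of_forall hMt))
    (by
      intro x _
      have h1 := hPnn x
      have h2 := hmβ1 x
      by_cases hx : x ∈ ball x₀ ε
      · rw [hvin x hx t₀ ht₀ε]
        have h3 := hε3 x hx
        simp only [hJ] at h3
        simp only [hφ]
        linarith
      · rw [hvout x hx]
        linarith)
  have hLv : linearOperator s K v x₀ t₀ = ∫ y, delta s (fun x => v x t₀) x₀ y * K x₀ y t₀ := rfl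
  rw [← hLv] at hL
  have hfx := hf x₀ hx₀R t₀ ht₀R
  rw [hderiv] at key
  unfold decayRate at key
  rw [← hβ] at hL
  rw [← hℓ, ← hV] at key
  have hb1 : β x₀ ≤ 1 := bump_le_one c r x₀
  -- By the choice of `decayRate`, the terms proportional to `β x₀` cancel in the equation at the
  -- touching point, except `ℓ V τ β x₀`; this is less than `gap` and contradicts `hη`.
  have hfin : ℓ * V * τ * β x₀ ≤ ℓ * V * τ * 1 := by gcongr
  linarith

/-! ### Scale-invariant constants and the growth lemma -/

/-- Dominated convergence; it makes the source of the differential equation for `m` continuous. -/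
lemma continuousOn_integral_ball {w : Space d → ℝ → ℝ} {U : Set (Space d)} {I I' : Set ℝ}
    {c : Space d} {r M : ℝ} (hcont : ContinuousOn (fun p : Space d × ℝ => w p.1 p.2) (U ×ˢ I))
    (hmeas : ∀ t ∈ I, AEMeasurable fun x => w x t) (hM : ∀ x, ∀ t ∈ I, |w x t| ≤ M)
    (hball : ball c r ⊆ U) (hI : I' ⊆ I) :
    ContinuousOn (fun t => ∫ x in ball c r, w x t) I' := by
  have hmem : ∀ᵐ x ∂(volume.restrict (ball c r)), x ∈ ball c r :=
    ae_restrict_mem measurableSet_ball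
  have hslice : ∀ x ∈ ball c r, ContinuousOn (fun t => w x t) I' := fun x hx =>
    ContinuousOn.comp (g := fun p : Space d × ℝ => w p.1 p.2) (f := fun t => (x, t)) hcont
      (continuous_const.prodMk continuous_id).continuousOn fun t ht => ⟨hball hx, hI ht⟩
  have hfin : IntegrableOn (fun _ : Space d => M) (ball c r) :=
    integrableOn_const measure_ball_lt_top.ne
  have hbound : ∀ t ∈ I', ∀ᵐ x ∂(volume.restrict (ball c r)), ‖w x t‖ ≤ M := fun t ht =>
    Eventually.of_forall fun x => hM x t (hI ht)
  have hms : ∀ t ∈ I', AEStronglyMeasurable (fun x => w x t) (volume.restrict (ball c r)) :=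
    fun t ht => (hmeas t (hI ht)).aestronglyMeasurable.restrict
  exact continuousOn_of_dominated (F := fun t x => w x t) hms hbound hfin (hmem.mono hslice)

lemma volume_real_ball {r : ℝ} (hr : 0 < r) (c : Space d) :
    volume.real (ball c r) = r ^ d * volume.real (ball (0 : Space d) 1) := by
  rw [measureReal_def, Measure.addHaar_ball_of_pos volume c hr, ENNReal.toReal_mul,
    ENNReal.toReal_ofReal (by positivity), finrank_euclideanSpace, Fintype.card_fin,
    measureReal_def]

/-- The volume of the unit ball. -/
def unitVolume (d : ℕ) : ℝ := volume.real (ball (0 : Space d) 1)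

/-- The scale-invariant lower bound for the kernel mass of a unit ball at distance `N`. -/
def kernelMass (d : ℕ) (s lam N : ℝ) : ℝ := lam * (N + 1) ^ (-(d : ℝ) - 2 * s) * unitVolume d

/-- The scale-invariant factor by which the barrier height decays. -/
def decayFactor (d : ℕ) (s lam Lam : ℝ) : ℝ :=
  Real.exp (-(2 * (2 * (Lam * profileIntegral d s) + lam * unitVolume d)))

/-- The size of the penalty relative to the barrier height. -/
def penaltySize (s : ℝ) : ℝ := 5 / (1 - 2 ^ (-(s / 2)))

lemma unitVolume_pos (d : ℕ) : 0 < unitVolume d :=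
  ENNReal.toReal_pos (measure_ball_pos _ _ one_pos).ne' measure_ball_lt_top.ne

lemma kernelMass_pos {s lam N : ℝ} (hlam : 0 < lam) (hN : 0 < N) : 0 < kernelMass d s lam N := by
  have := unitVolume_pos d
  unfold kernelMass; positivity

lemma penalty_gap_pos {s : ℝ} (hs : 0 < s) : 0 < 1 - (2 : ℝ) ^ (-(s / 2)) :=
  sub_pos.2 (Real.rpow_lt_one_of_one_lt_of_neg (by norm_num) (by linarith))

lemma penaltySize_pos {s : ℝ} (hs : 0 < s) : 0 < penaltySize s :=
  div_pos (by norm_num) (penalty_gap_pos hs)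

lemma lowerConst_mul_volume {s lam N r : ℝ} (hN : 0 < N) (hr : 0 < r) (c : Space d) :
    lowerConst d s lam N r * volume.real (ball c r) = kernelMass d s lam N * r ^ (-2 * s) := by
  unfold lowerConst kernelMass unitVolume
  rw [volume_real_ball hr, Real.mul_rpow (by linarith) hr.le, ← Real.rpow_natCast]
  have : r ^ (-(d : ℝ) - 2 * s) * r ^ (d : ℝ) = r ^ (-2 * s) := by
    rw [← Real.rpow_add hr]; congr 1; ring
  linear_combination lam * (N + 1) ^ (-(d : ℝ) - 2 * s) *
    volume.real (ball (0 : Space d) 1) * this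

lemma rpow_neg_two_mul_cancel {r : ℝ} (hr : 0 < r) (s : ℝ) : r ^ (-2 * s) * r ^ (2 * s) = 1 := by
  rw [← Real.rpow_add hr]; simp

/-- The penalty dominates the barrier height plus a power tail outside the ball of radius `N r`. -/
lemma tail_le_penalty {s N r a κ α : ℝ} {c x : Space d} (hs : s ∈ Ioo (0 : ℝ) 1) (hr : 0 < r)
    (hN0 : 0 < N) (ha : 0 < a) (hκ0 : 0 < κ) (hα0 : 0 < α) (hαs : α ≤ s)
    (hα : 2 * (α / s) * N ^ s ≤ κ) (hx : N * r ≤ ‖x - c‖) :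
    4 * a * κ + 2 * a * ((‖x - c‖ / r) ^ α - 1) ≤
      a * κ * penaltySize s * penalty s c (N * r) x := by
  have hq : 0 < N * r := mul_pos hN0 hr
  set B := penaltySize s with hB
  have hB0 : 0 < B := penaltySize_pos hs.1
  set X := ‖x - c‖ / (N * r) with hX
  have hX1 : 1 ≤ X := (one_le_div hq).2 hx
  have hXs : 1 ≤ X ^ s := Real.one_le_rpow hX1 hs.1.le
  -- The `5` in `penaltySize` splits as `4 + 1`: four parts for the barrier height, one for the
  -- tail.
  have h1 : 5 * (a * κ) * X ^ s ≤ a * κ * B * penalty s c (N * r) x := by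
    have h2 := mul_le_mul_of_nonneg_left (le_penalty hs hq hx)
      (show 0 ≤ a * κ * B by positivity)
    refine le_trans (le_of_eq ?_) h2
    have h3 : B * (1 - 2 ^ (-(s / 2))) = 5 := div_mul_cancel₀ _ (penalty_gap_pos hs.1).ne'
    rw [← hX]
    linear_combination -(a * κ * X ^ s) * h3
  have hY : ‖x - c‖ / r = N * X := by rw [hX]; field_simp
  -- Bernoulli's inequality for `Y ^ α = (Y ^ s) ^ (α / s)` produces the small factor `α / s`.
  have h4 : (N * X) ^ α - 1 ≤ (α / s) * (N ^ s * X ^ s) := by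
    have hNX : 0 ≤ N * X := by positivity
    have h5 : (N * X) ^ α = ((N * X) ^ s) ^ (α / s) := by
      rw [← Real.rpow_mul hNX]; congr 1; field_simp [hs.1.ne']
    have h6 : 0 ≤ (N * X) ^ s := by positivity
    have h7 := rpow_one_add_le_one_add_mul_self (s := (N * X) ^ s - 1) (by linarith)
      (p := α / s) (by have := hs.1; positivity) ((div_le_one hs.1).2 hαs)
    rw [add_sub_cancel, ← h5] at h7
    rw [← Real.mul_rpow hN0.le (by linarith)]
    have h8 : 0 < α / s := div_pos hα0 hs.1
    nlinarith
  rw [hY]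
  have h9 : 2 * a * ((N * X) ^ α - 1) ≤ a * κ * X ^ s := by
    calc 2 * a * ((N * X) ^ α - 1) ≤ 2 * a * ((α / s) * (N ^ s * X ^ s)) := by gcongr
      _ = a * (2 * (α / s) * N ^ s) * X ^ s := by ring
      _ ≤ a * κ * X ^ s := by gcongr
  have h10 : 4 * a * κ ≤ 4 * (a * κ) * X ^ s := by
    have := le_mul_of_one_le_right (show 0 ≤ 4 * (a * κ) by positivity) hXs
    linarith
  linarith

set_option maxHeartbeats 800000 in
/-- Growth lemma: a supersolution with enough mass in the earlier half of a cylinder is bounded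
below in the later half of the cylinder. -/
theorem growth_lemma {s lam Lam ρ R F N r tb a α : ℝ} {K : Space d → Space d → ℝ → ℝ}
    {f w : Space d → ℝ → ℝ} {c : Space d} (hd : 1 ≤ d) (hs : s ∈ Ioo (0 : ℝ) 1)
    (hlam : 0 < lam) (hLam : 0 ≤ Lam) (hρ : 0 < ρ) (hK : IsAdmissibleKernel s lam Lam ρ R K)
    (hw : IsViscositySupersolution (linearOperator s K) f (ball 0 R) (timeInterval s R) w)
    (hcont : ContinuousOn (fun p : Space d × ℝ => w p.1 p.2) (ball 0 R ×ˢ timeInterval s R))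
    (hf : ∀ x ∈ ball (0 : Space d) R, ∀ t ∈ timeInterval s R, -F ≤ f x t)
    (hr : 0 < r) (hN : 1 ≤ N) (hball : closedBall c (N * r) ⊆ ball 0 R)
    (hρr : ρ ≤ (N + 1) * r) (hI : Icc (tb - 2 * r ^ (2 * s)) tb ⊆ timeInterval s R)
    (hNs : penaltySize s / N ^ 2 +
      8 * (Lam * profileIntegral d s) * penaltySize s * N ^ (-2 * s) ≤ decayFactor d s lam Lam / 8)
    (ha : 0 < a) (hF0 : 0 ≤ F)
    (hF : F * r ^ (2 * s) ≤ a * kernelMass d s lam N * decayFactor d s lam Lam / 16)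
    (hα0 : 0 < α) (hαs : α ≤ s) (hα : 2 * (α / s) * N ^ s ≤ kernelMass d s lam N)
    (hin : ∀ t ∈ Icc (tb - 2 * r ^ (2 * s)) tb, ∀ x ∈ ball c (N * r), 0 ≤ w x t ∧ w x t ≤ 2 * a)
    (htail : ∀ t ∈ Icc (tb - 2 * r ^ (2 * s)) tb, ∀ x, N * r ≤ ‖x - c‖ →
      -(2 * a * ((‖x - c‖ / r) ^ α - 1)) ≤ w x t)
    (hmass : a * volume.real (ball c r) * r ^ (2 * s) ≤
      ∫ t in (tb - 2 * r ^ (2 * s))..(tb - r ^ (2 * s)), ∫ x in ball c r, w x t) :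
    ∀ t ∈ Icc (tb - r ^ (2 * s)) tb, ∀ x ∈ ball c r,
      a * (kernelMass d s lam N * decayFactor d s lam Lam / 8) ≤ w x t := by
  set T := r ^ (2 * s) with hT
  have hT0 : 0 < T := Real.rpow_pos_of_pos hr _
  have hrT : r ^ (-2 * s) * T = 1 := rpow_neg_two_mul_cancel hr s
  set κ := kernelMass d s lam N with hκ
  have hN0 : 0 < N := by linarith
  have hq : 0 < N * r := mul_pos hN0 hr
  have hκ0 : 0 < κ := kernelMass_pos hlam hN0
  set e := decayFactor d s lam Lam with he
  have he0 : 0 < e := Real.exp_pos _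
  set B := penaltySize s with hB
  have hB0 : 0 < B := penaltySize_pos hs.1
  set H := Lam * profileIntegral d s with hH
  have hH0 : 0 ≤ H := mul_nonneg hLam (profileIntegral_nonneg d s)
  set ℓ := lowerConst d s lam N r with hℓ
  have hℓ0 : 0 ≤ ℓ := by rw [hℓ]; unfold lowerConst; positivity
  set V := volume.real (ball c r) with hV
  have hV0 : 0 ≤ V := measureReal_nonneg
  have hℓV : ℓ * V = κ * r ^ (-2 * s) := lowerConst_mul_volume hN0 hr c
  have hℓVT : ℓ * V * T = κ := by rw [hℓV, mul_assoc, hrT, mul_one]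
  have hballr : ball c r ⊆ ball c (N * r) := ball_subset_ball (by nlinarith)
  have h12 : tb - 2 * T ≤ tb := by linarith
  obtain ⟨M, hM⟩ := hw.bounded.1
  set g : ℝ → ℝ := fun t => ∫ x in ball c r, w x t with hg
  have hgc : ContinuousOn g (Icc (tb - 2 * T) tb) :=
    continuousOn_integral_ball hcont hw.bounded.2 hM
      (hballr.trans (ball_subset_closedBall.trans hball)) hI
  have hwint : ∀ t ∈ Icc (tb - 2 * T) tb, IntegrableOn (fun x => w x t) (ball c r) := fun t ht =>
    Measure.integrableOn_of_bounded (M := M) measure_ball_lt_top.ne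
      (hw.bounded.2 t (hI ht)).aestronglyMeasurable (Eventually.of_forall fun x => hM x t (hI ht))
  have hg0 : ∀ t ∈ Icc (tb - 2 * T) tb, 0 ≤ g t := fun t ht =>
    setIntegral_nonneg measurableSet_ball fun x hx => (hin t ht x (hballr hx)).1
  have hg2 : ∀ t ∈ Icc (tb - 2 * T) tb, g t ≤ 2 * a * V := fun t ht => by
    have h1 : g t ≤ ∫ _ in ball c r, 2 * a :=
      setIntegral_mono_on (hwint t ht) (integrableOn_const measure_ball_lt_top.ne)
        measurableSet_ball fun x hx => (hin t ht x (hballr hx)).2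
    rw [setIntegral_const, smul_eq_mul] at h1
    linarith
  have hD0 : 0 ≤ decayRate s lam Lam N r c := by unfold decayRate; positivity
  obtain ⟨m, hm0, hmd, hmnn, hmub, hmlb⟩ := exists_linear_ode h12 hgc hg0 hℓ0 hD0
  -- Mass at most `2 a V` during a time `2 T`, with `ℓ V T = κ`.
  have hm4 : ∀ t ∈ Icc (tb - 2 * T) tb, m t ≤ 4 * a * κ := fun t ht => by
    have h1 := hmub _ hg2 t ht
    calc m t ≤ _ := h1
      _ = 4 * a * (ℓ * V * T) := by ring
      _ = _ := by rw [hℓVT]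
  set A := a * κ * B with hA
  have hA0 : 0 ≤ A := by positivity
  -- The last summand is the strict slack required by `barrier_le`; over the time `2 T` it costs `a
  -- κ e / 8`.
  set η := F + A * (4 * (H * (N * r) ^ (-2 * s))) + a * κ * e / (16 * T) with hη
  have hη1 : F + A * (4 * (H * (N * r) ^ (-2 * s))) < η := by
    have : 0 < a * κ * e / (16 * T) := by positivity
    linarith
  have hη0 : 0 ≤ η := by positivity
  have hout : ∀ t ∈ Icc (tb - 2 * T) tb, ∀ x, N * r ≤ ‖x - c‖ →
      m t * bump c r x - A * penalty s c (N * r) x ≤ w x t := by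
    intro t ht x hx
    have h1 := tail_le_penalty hs hr hN0 ha hκ0 hα0 hαs hα hx
    have h2 := htail t ht x hx
    have h3 := mul_le_of_le_one_right (hmnn t ht) (bump_le_one c r x)
    linarith [hm4 t ht]
  have hlow : ∀ t ∈ Icc (tb - 2 * T) tb, ∀ x, -(A * penalty s c (N * r) x) ≤ w x t := by
    intro t ht x
    rcases lt_or_ge ‖x - c‖ (N * r) with hx | hx
    · have h1 := (hin t ht x (mem_ball_iff_norm.2 hx)).1
      have h2 := mul_nonneg hA0 (penalty_nonneg hs.1.le c (N * r) x)
      linarith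
    · have h1 := hout t ht x hx
      have h2 := mul_nonneg (hmnn t ht) (bump_pos c r x).le
      linarith
  intro t ht x hx
  have ht' : t ∈ Icc (tb - 2 * T) tb := ⟨by linarith [ht.1], ht.2⟩
  have hxn : ‖x - c‖ < r := mem_ball_iff_norm.1 hx
  have hbar := barrier_le hd hs hlam.le hρ hK hw hcont hf hr hN0 hball hρr hI hA0 hm0 hmnn hmd hη0
    hη1 hlow hout (ball_subset_closedBall (hballr hx)) ht'
  refine le_trans ?_ hbar
  have hmt : a * κ * e ≤ m t := by
    have h1 := hmlb (tb - T) t (by linarith) ht.1 ht.2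
    refine le_trans ?_ h1
    have h2 : e ≤ Real.exp (-decayRate s lam Lam N r c * (tb - (tb - 2 * T))) := by
      rw [he]
      unfold decayFactor
      rw [Real.exp_le_exp]
      have h3 : decayRate s lam Lam N r c * T = 2 * H + κ := by
        have : decayRate s lam Lam N r c = 2 * (H * r ^ (-2 * s)) + ℓ * V := rfl
        rw [this, add_mul, hℓVT]
        linear_combination 2 * H * hrT
      -- Bounding `κ` by a quantity free of `N` makes `decayFactor` independent of `N`, so that `N`
      -- can be chosen after it.
      have h4 : κ ≤ lam * unitVolume d := by
        rw [hκ]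
        unfold kernelMass
        have h5 : (N + 1) ^ (-(d : ℝ) - 2 * s) ≤ 1 :=
          Real.rpow_le_one_of_one_le_of_nonpos (by linarith)
            (by linarith [(Nat.cast_nonneg d : (0 : ℝ) ≤ d), hs.1])
        have h6 := unitVolume_pos d
        nlinarith [mul_pos hlam h6]
      linarith
    calc a * κ * e = ℓ * (e * (a * V * T)) := by rw [← hℓVT]; ring
      _ ≤ _ := by gcongr
  have hbump : 1 / 2 ≤ bump c r x := by
    unfold bump
    rw [one_div]
    refine inv_anti₀ (quad_pos c r x) ?_
    unfold quad
    have : ‖x - c‖ ^ 2 / r ^ 2 ≤ 1 := by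
      rw [div_le_one (by positivity)]; gcongr
    linarith
  have hpen : A * penalty s c (N * r) x ≤ a * κ * (B / N ^ 2) := by
    have h1 : penalty s c (N * r) x ≤ 1 / N ^ 2 := by
      refine (penalty_le hs c _ x).trans ?_
      rw [mul_pow, div_le_div_iff₀ (by positivity) (by positivity)]
      have : ‖x - c‖ ^ 2 ≤ r ^ 2 := by gcongr
      nlinarith [sq_nonneg N]
    calc A * penalty s c (N * r) x ≤ A * (1 / N ^ 2) := by gcongr
      _ = _ := by rw [hA]; ring
  have hηT : η * (t - (tb - 2 * T)) ≤
      2 * (F * T) + a * κ * (8 * H * B * N ^ (-2 * s)) + a * κ * e / 8 := by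
    have h1 : η * (t - (tb - 2 * T)) ≤ η * (2 * T) := by gcongr; linarith [ht.2]
    refine h1.trans (le_of_eq ?_)
    have h2 : a * κ * e / (16 * T) * (2 * T) = a * κ * e / 8 := by field_simp; norm_num
    have h3 : (N * r) ^ (-2 * s) * T = N ^ (-2 * s) := by
      rw [Real.mul_rpow hN0.le hr.le, mul_assoc, hrT, mul_one]
    rw [hη, add_mul, h2, hA]
    linear_combination 8 * H * (a * κ * B) * h3
  have hmb : a * κ * e / 2 ≤ m t * bump c r x := by
    have h1 : 0 ≤ a * κ * e := by positivity
    have h2 := hmnn t ht'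
    calc a * κ * e / 2 = (a * κ * e) * (1 / 2) := by ring
      _ ≤ _ := by gcongr
  -- Budget in units of `a κ e / 8`: the bump term supplies four; the penalty (its value and its
  -- share of `η`), the source and the slack cost at most one each, and one remains.
  have hsum := mul_le_mul_of_nonneg_left hNs (show 0 ≤ a * κ by positivity)
  have e1 : a * (κ * e / 8) = a * κ * e / 8 := by ring
  rw [e1]
  have e2 : a * κ * (B / N ^ 2 + 8 * H * B * N ^ (-2 * s)) =
    a * κ * (B / N ^ 2) + a * κ * (8 * H * B * N ^ (-2 * s)) := by ring
  have e3 : a * κ * (e / 8) = a * κ * e / 8 := by ring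
  rw [e2, e3] at hsum
  linarith

/-! ### Decay of oscillation from scale to scale -/

/-- Scale ratios `N` and Hölder exponents `α` for which the oscillation decays. -/
structure IsDecayPair (d : ℕ) (s lam Lam N α : ℝ) : Prop where
  one_lt : 1 < N
  two_le : 2 ≤ N ^ (2 * s)
  penalty_small : penaltySize s / N ^ 2 +
    8 * (Lam * profileIntegral d s) * penaltySize s * N ^ (-2 * s) ≤ decayFactor d s lam Lam / 8
  pos : 0 < α
  le : α ≤ s
  tail_small : 2 * (α / s) * N ^ s ≤ kernelMass d s lam N
  contraction : 1 - kernelMass d s lam N * decayFactor d s lam Lam / 16 ≤ N ^ (-α)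

lemma exists_isDecayPair (d : ℕ) {s lam : ℝ} (Lam : ℝ) (hs : s ∈ Ioo (0 : ℝ) 1) (hlam : 0 < lam) :
    ∃ N α, IsDecayPair d s lam Lam N α := by
  have hs0 := hs.1
  have he : 0 < decayFactor d s lam Lam := Real.exp_pos _
  have h1 : Tendsto (fun N : ℝ => penaltySize s / N ^ 2 +
      8 * (Lam * profileIntegral d s) * penaltySize s * N ^ (-2 * s)) atTop (𝓝 0) := by
    have e1 : Tendsto (fun N : ℝ => penaltySize s / N ^ 2) atTop (𝓝 0) :=
      tendsto_const_nhds.div_atTop (tendsto_pow_atTop two_ne_zero)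
    have e2 : Tendsto (fun N : ℝ => N ^ (-2 * s)) atTop (𝓝 0) := by
      simpa only [neg_mul] using tendsto_rpow_neg_atTop (show 0 < 2 * s by linarith)
    simpa using e1.add (e2.const_mul (8 * (Lam * profileIntegral d s) * penaltySize s))
  have h2 : Tendsto (fun N : ℝ => N ^ (2 * s)) atTop atTop :=
    tendsto_rpow_atTop (show 0 < 2 * s by linarith)
  obtain ⟨N, hN1, hN2, hN3⟩ := ((h1.eventually_le_const (show 0 < decayFactor d s lam Lam / 8 by
    positivity)).and ((h2.eventually_ge_atTop 2).and (eventually_gt_atTop 1))).exists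
  have hN0 : 0 < N := by linarith
  have hκ : 0 < kernelMass d s lam N := kernelMass_pos hlam hN0
  set κ := kernelMass d s lam N
  set e := decayFactor d s lam Lam
  -- `N` is fixed first. Then `α` is small enough for the tail condition and for `N ^ α ≤ 1 + α (N -
  -- 1) ≤ 1 + κ e / 16`, whence the contraction.
  set α := min s (min (s * κ / (2 * N ^ s)) (κ * e / (16 * N))) with hα
  have hα0 : 0 < α := by
    refine lt_min hs0 (lt_min ?_ ?_) <;> positivity
  have hαs : α ≤ s := min_le_left _ _
  have hα1 : α ≤ s * κ / (2 * N ^ s) := (min_le_right _ _).trans (min_le_left _ _)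
  have hα2 : α ≤ κ * e / (16 * N) := (min_le_right _ _).trans (min_le_right _ _)
  refine ⟨N, α, hN3, hN2, hN1, hα0, hαs, ?_, ?_⟩
  · have hNs : 0 < N ^ s := by positivity
    rw [le_div_iff₀ (by positivity)] at hα1
    have : 2 * (α / s) * N ^ s = (α * (2 * N ^ s)) / s := by ring
    rw [this, div_le_iff₀ hs0]
    linarith
  · rw [le_div_iff₀ (by positivity)] at hα2
    have h3 := rpow_one_add_le_one_add_mul_self (s := N - 1) (by linarith) hα0.le
      (hαs.trans hs.2.le)
    rw [add_sub_cancel] at h3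
    have h4 : 0 < N ^ α := by positivity
    have h5 : N ^ α * N ^ (-α) = 1 := by rw [← Real.rpow_add hN0]; simp
    have h6 : 0 < N ^ (-α) := by positivity
    have h7 : N ^ α ≤ 1 + κ * e / 16 := by nlinarith
    have h8 : 1 ≤ (1 + κ * e / 16) * N ^ (-α) := by
      calc (1 : ℝ) = N ^ α * N ^ (-α) := h5.symm
        _ ≤ _ := by gcongr
    have h9 : N ^ (-α) ≤ 1 := Real.rpow_le_one_of_one_le_of_nonpos hN3.le (by linarith)
    have h10 : 0 < κ * e := by positivity
    nlinarith

/-- `u` oscillates by at most `2 a` on the cylinder of radius `N r` with vertex `(c, tb)`, and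
grows at most like a power `α` of the distance outside it. -/
def HasOscillationBound (s N α : ℝ) (u : Space d → ℝ → ℝ) (c : Space d) (tb r a : ℝ) : Prop :=
  ∃ l, (∀ t ∈ Icc (tb - 2 * r ^ (2 * s)) tb, ∀ x ∈ ball c (N * r), l ≤ u x t ∧ u x t ≤ l + 2 * a) ∧
    ∀ t ∈ Icc (tb - 2 * r ^ (2 * s)) tb, ∀ x, N * r ≤ ‖x - c‖ →
      l - 2 * a * ((‖x - c‖ / r) ^ α - 1) ≤ u x t ∧
      u x t ≤ l + 2 * a + 2 * a * ((‖x - c‖ / r) ^ α - 1)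

/-- The growth lemma raises the lower bound of `u` or lowers its upper bound by `a κ e / 8`, which
is at least `2a - 2a N ^ (-α)`. -/
lemma exists_subinterval_of_oscillation {s lam Lam ρ R F N r tb a α l : ℝ}
    {K : Space d → Space d → ℝ → ℝ}
    {f u : Space d → ℝ → ℝ} {c : Space d} (hd : 1 ≤ d) (hs : s ∈ Ioo (0 : ℝ) 1)
    (hlam : 0 < lam) (hLam : 0 ≤ Lam) (hρ : 0 < ρ) (hK : IsAdmissibleKernel s lam Lam ρ R K)
    (hu : IsViscositySolution (linearOperator s K) f (ball 0 R) (timeInterval s R) u)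
    (hf : ∀ x ∈ ball (0 : Space d) R, ∀ t ∈ timeInterval s R, |f x t| ≤ F)
    (hNα : IsDecayPair d s lam Lam N α)
    (hr : 0 < r) (hball : closedBall c (N * r) ⊆ ball 0 R)
    (hρr : ρ ≤ (N + 1) * r) (hI : Icc (tb - 2 * r ^ (2 * s)) tb ⊆ timeInterval s R)
    (ha : 0 < a) (hF0 : 0 ≤ F)
    (hF : F * r ^ (2 * s) ≤ a * kernelMass d s lam N * decayFactor d s lam Lam / 16)
    (hin : ∀ t ∈ Icc (tb - 2 * r ^ (2 * s)) tb, ∀ x ∈ ball c (N * r),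
      l ≤ u x t ∧ u x t ≤ l + 2 * a)
    (htail : ∀ t ∈ Icc (tb - 2 * r ^ (2 * s)) tb, ∀ x, N * r ≤ ‖x - c‖ →
      l - 2 * a * ((‖x - c‖ / r) ^ α - 1) ≤ u x t ∧
      u x t ≤ l + 2 * a + 2 * a * ((‖x - c‖ / r) ^ α - 1)) :
    ∃ l', l ≤ l' ∧ l' + 2 * (a * N ^ (-α)) ≤ l + 2 * a ∧
      ∀ t ∈ Icc (tb - r ^ (2 * s)) tb, ∀ x ∈ ball c r,
        l' ≤ u x t ∧ u x t ≤ l' + 2 * (a * N ^ (-α)) := by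
  have hcont : ContinuousOn (fun p : Space d × ℝ => u p.1 p.2) (ball 0 R ×ˢ timeInterval s R) :=
    continuousOn_iff_lower_upperSemicontinuousOn.2 ⟨hu.2.semicontinuous, hu.1.semicontinuous⟩
  have hN1 := hNα.one_lt
  have hT0 : 0 < r ^ (2 * s) := Real.rpow_pos_of_pos hr _
  set T := r ^ (2 * s) with hT
  set V := volume.real (ball c r) with hV
  have hμ : a * (2 - kernelMass d s lam N * decayFactor d s lam Lam / 8) ≤ 2 * (a * N ^ (-α)) := by
    have := mul_le_mul_of_nonneg_left hNα.contraction ha.le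
    linarith
  have hμ1 : N ^ (-α) ≤ 1 :=
    Real.rpow_le_one_of_one_le_of_nonpos hN1.le (by linarith [hNα.pos])
  have hsmall : ∀ t ∈ Icc (tb - T) tb, ∀ x ∈ ball c r, l ≤ u x t ∧ u x t ≤ l + 2 * a :=
    fun t ht x hx => hin t ⟨by linarith [ht.1], ht.2⟩ x
      (ball_subset_ball (le_mul_of_one_le_left hr.le hN1.le) hx)
  obtain ⟨M, hM⟩ := hu.1.bounded.1
  have hmeas := hu.1.bounded.2
  have hIi : Icc (tb - 2 * T) (tb - T) ⊆ timeInterval s R :=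
    (Icc_subset_Icc_right (by linarith)).trans hI
  have hballR : ball c r ⊆ ball 0 R :=
    (ball_subset_ball (le_mul_of_one_le_left hr.le hN1.le)).trans
      (ball_subset_closedBall.trans hball)
  set g : ℝ → ℝ := fun t => ∫ x in ball c r, u x t with hg
  have hgi : IntervalIntegrable g volume (tb - 2 * T) (tb - T) :=
    (continuousOn_integral_ball hcont hmeas hM hballR hIi).intervalIntegrable_of_Icc (by linarith)
  have huint : ∀ t ∈ Icc (tb - 2 * T) (tb - T), IntegrableOn (fun x => u x t) (ball c r) :=
    fun t ht => Measure.integrableOn_of_bounded (M := M) measure_ball_lt_top.ne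
      (hmeas t (hIi ht)).aestronglyMeasurable (Eventually.of_forall fun x => hM x t (hIi ht))
  have hcst : ∀ b : ℝ, IntegrableOn (fun _ : Space d => b) (ball c r) := fun b =>
    integrableOn_const measure_ball_lt_top.ne
  have hle : tb - 2 * T ≤ tb - T := by linarith
  have hi1 : ∀ b : ℝ, ∫ t in (tb - 2 * T)..(tb - T), ∫ x in ball c r, (u x t + b) =
      (∫ t in (tb - 2 * T)..(tb - T), g t) + T * (V * b) := by
    intro b
    have h1 : ∫ t in (tb - 2 * T)..(tb - T), ∫ x in ball c r, (u x t + b) =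
        ∫ t in (tb - 2 * T)..(tb - T), (g t + V * b) := by
      refine intervalIntegral.integral_congr fun t ht => ?_
      rw [uIcc_of_le hle] at ht
      simp only [hg]
      rw [integral_add (huint t ht) (hcst b), setIntegral_const, smul_eq_mul]
    rw [h1, intervalIntegral.integral_add hgi intervalIntegrable_const,
      intervalIntegral.integral_const, smul_eq_mul]
    ring
  have hi2 : ∀ b : ℝ, ∫ t in (tb - 2 * T)..(tb - T), ∫ x in ball c r, (-u x t + b) =
      -(∫ t in (tb - 2 * T)..(tb - T), g t) + T * (V * b) := by
    intro b
    have h1 : ∫ t in (tb - 2 * T)..(tb - T), ∫ x in ball c r, (-u x t + b) =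
        ∫ t in (tb - 2 * T)..(tb - T), (-g t + V * b) := by
      refine intervalIntegral.integral_congr fun t ht => ?_
      rw [uIcc_of_le hle] at ht
      simp only [hg]
      have hun : IntegrableOn (fun x => -u x t) (ball c r) := (huint t ht).neg
      rw [integral_add hun (hcst b), setIntegral_const, smul_eq_mul, integral_neg]
    have hgn : IntervalIntegrable (fun t => -g t) volume (tb - 2 * T) (tb - T) := hgi.neg
    rw [h1, intervalIntegral.integral_add hgn intervalIntegrable_const,
      intervalIntegral.integral_const, smul_eq_mul, intervalIntegral.integral_neg]
    ring
  -- The integrals of `u - l` and `l + 2a - u` over the earlier half add up to `2 a V T`, so one of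
  -- them is at least `a V T`.
  rcases le_total (a * V * T) ((∫ t in (tb - 2 * T)..(tb - T), g t) + T * (V * -l)) with hm | hm
  · refine ⟨l + 2 * a - 2 * (a * N ^ (-α)), by nlinarith, by linarith, fun t ht x hx => ?_⟩
    have h := growth_lemma (w := fun x t => u x t + -l) hd hs hlam hLam hρ hK
      (hu.2.add_const (-l)) (hcont.add continuousOn_const)
      (fun x hx t ht => (abs_le.1 (hf x hx t ht)).1) hr hN1.le hball hρr hI hNα.penalty_small ha hF0
      hF hNα.pos hNα.le hNα.tail_small
      (fun t ht x hx => by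
        have := hin t ht x hx
        constructor <;> linarith)
      (fun t ht x hx => by
        have := (htail t ht x hx).1
        linarith)
      (by rw [hi1]; exact hm) t ht x hx
    have h2 := hsmall t ht x hx
    constructor <;> linarith
  · refine ⟨l, le_rfl, by nlinarith, fun t ht x hx => ?_⟩
    have h := growth_lemma (w := fun x t => -u x t + (l + 2 * a)) hd hs hlam hLam hρ hK
      (hu.1.neg.add_const (l + 2 * a)) (hcont.neg.add continuousOn_const)
      (fun x hx t ht => neg_le_neg (abs_le.1 (hf x hx t ht)).2) hr hN1.le hball hρr hI
      hNα.penalty_small ha hF0 hF hNα.pos hNα.le hNα.tail_small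
      (fun t ht x hx => by
        have := hin t ht x hx
        constructor <;> linarith)
      (fun t ht x hx => by
        have := (htail t ht x hx).2
        linarith)
      (by rw [hi2]; linarith) t ht x hx
    have h2 := hsmall t ht x hx
    constructor <;> linarith

/-- Decay of the oscillation from one scale to the next. -/
theorem HasOscillationBound.step {s lam Lam ρ R F N r tb a α : ℝ}
    {K : Space d → Space d → ℝ → ℝ}
    {f u : Space d → ℝ → ℝ} {c : Space d} (hd : 1 ≤ d) (hs : s ∈ Ioo (0 : ℝ) 1)
    (hlam : 0 < lam) (hLam : 0 ≤ Lam) (hρ : 0 < ρ) (hK : IsAdmissibleKernel s lam Lam ρ R K)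
    (hu : IsViscositySolution (linearOperator s K) f (ball 0 R) (timeInterval s R) u)
    (hf : ∀ x ∈ ball (0 : Space d) R, ∀ t ∈ timeInterval s R, |f x t| ≤ F)
    (hNα : IsDecayPair d s lam Lam N α)
    (hr : 0 < r) (hball : closedBall c (N * r) ⊆ ball 0 R)
    (hρr : ρ ≤ (N + 1) * r) (hI : Icc (tb - 2 * r ^ (2 * s)) tb ⊆ timeInterval s R)
    (ha : 0 < a) (hF0 : 0 ≤ F)
    (hF : F * r ^ (2 * s) ≤ a * kernelMass d s lam N * decayFactor d s lam Lam / 16)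
    (h : HasOscillationBound s N α u c tb r a) :
    HasOscillationBound s N α u c tb (r / N) (a * N ^ (-α)) := by
  obtain ⟨l, hin, htail⟩ := h
  obtain ⟨l', hl1, hl2, hl'⟩ := exists_subinterval_of_oscillation hd hs hlam hLam hρ hK hu hf hNα hr
    hball hρr hI ha hF0 hF hin htail
  have hN0 : 0 < N := zero_lt_one.trans hNα.one_lt
  have hrN : N * (r / N) = r := mul_div_cancel₀ r hN0.ne'
  -- The whole next time interval lies in the later half of the present one, where the improved
  -- bounds hold.
  have hTT : 2 * (r / N) ^ (2 * s) ≤ r ^ (2 * s) := by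
    rw [Real.div_rpow hr.le hN0.le, ← mul_div_assoc, div_le_iff₀ (by positivity), mul_comm]
    gcongr
    exact hNα.two_le
  have hT0 : 0 < r ^ (2 * s) := by positivity
  have hμ : N ^ (-α) * N ^ α = 1 := by rw [← Real.rpow_add hN0]; simp
  refine ⟨l', fun t ht x hx => hl' t ⟨by linarith [ht.1], ht.2⟩ x (hrN ▸ hx), fun t ht x hx => ?_⟩
  rw [hrN] at hx
  have ht' : t ∈ Icc (tb - 2 * r ^ (2 * s)) tb := ⟨by linarith [ht.1], ht.2⟩
  have hX : ‖x - c‖ / (r / N) = N * (‖x - c‖ / r) := by field_simp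
  have hX1 : 1 ≤ ‖x - c‖ / r := (one_le_div hr).2 hx
  set X := ‖x - c‖ / r with hXdef
  have hpow : a * N ^ (-α) * (N * X) ^ α = a * X ^ α := by
    rw [Real.mul_rpow hN0.le (by linarith)]
    linear_combination a * X ^ α * hμ
  -- The new tail bounds become `l' + 2a N ^ (-α) - 2a X ^ α` and `l' + 2a X ^ α`. They are no
  -- tighter than the old ones, because the new interval of values lies inside the old one.
  have e1 : 2 * (a * N ^ (-α)) * ((N * X) ^ α - 1) = 2 * (a * X ^ α) - 2 * (a * N ^ (-α)) := by
    linear_combination 2 * hpow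
  rw [hX, e1]
  rcases lt_or_ge ‖x - c‖ (N * r) with hlt | hge
  · have h1 := hin t ht' x (mem_ball_iff_norm.2 hlt)
    have h2 : 1 ≤ X ^ α := Real.one_le_rpow hX1 hNα.pos.le
    have h3 := mul_le_mul_of_nonneg_left h2 ha.le
    constructor <;> linarith
  · have h1 := htail t ht' x hge
    rw [← hXdef] at h1
    constructor <;> linarith

/-- The smallness of the source persists because `F r ^ (2s)` shrinks by `N ^ (-2s) ≤ N ^ (-α)` at
each step. -/
theorem HasOscillationBound.iterate {s lam Lam ρ R F N r tb a α : ℝ}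
    {K : Space d → Space d → ℝ → ℝ}
    {f u : Space d → ℝ → ℝ} {c : Space d} (hd : 1 ≤ d) (hs : s ∈ Ioo (0 : ℝ) 1)
    (hlam : 0 < lam) (hLam : 0 ≤ Lam) (hρ : 0 < ρ) (hK : IsAdmissibleKernel s lam Lam ρ R K)
    (hu : IsViscositySolution (linearOperator s K) f (ball 0 R) (timeInterval s R) u)
    (hf : ∀ x ∈ ball (0 : Space d) R, ∀ t ∈ timeInterval s R, |f x t| ≤ F)
    (hNα : IsDecayPair d s lam Lam N α)
    (hr : 0 < r) (hball : closedBall c (N * r) ⊆ ball 0 R)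
    (hI : Icc (tb - 2 * r ^ (2 * s)) tb ⊆ timeInterval s R)
    (ha : 0 < a) (hF0 : 0 ≤ F)
    (hF : F * r ^ (2 * s) ≤ a * kernelMass d s lam N * decayFactor d s lam Lam / 16)
    (h : HasOscillationBound s N α u c tb r a) (k : ℕ) (hk : ρ ≤ r / N ^ k) :
    HasOscillationBound s N α u c tb (r / N ^ k) (a * (N ^ (-α)) ^ k) := by
  have hN1 := hNα.one_lt
  have hN0 : 0 < N := zero_lt_one.trans hN1
  have hs0 := hs.1
  induction k with
  | zero => simpa using h
  | succ k ih =>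
    have hNk : 1 ≤ N ^ k := one_le_pow₀ hN1.le
    have hrk : 0 < r / N ^ k := by positivity
    have hrr : r / N ^ (k + 1) = r / N ^ k / N := by rw [pow_succ, div_div]
    rw [hrr] at hk ⊢
    have hk' : ρ ≤ r / N ^ k := hk.trans (div_le_self hrk.le hN1.le)
    have hle : r / N ^ k ≤ r := div_le_self hr.le hNk
    have hμ : 0 < N ^ (-α) := by positivity
    have hT : (r / N ^ k) ^ (2 * s) ≤ r ^ (2 * s) := by gcongr
    rw [pow_succ, ← mul_assoc]
    refine (ih hk').step hd hs hlam hLam hρ hK hu hf hNα hrk ?_ ?_ ?_ (by positivity) hF0 ?_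
    · exact (closedBall_subset_closedBall (by gcongr)).trans hball
    · nlinarith
    · exact (Icc_subset_Icc_left (by linarith)).trans hI
    · have h1 : (r / N ^ k) ^ (2 * s) ≤ r ^ (2 * s) * (N ^ (-α)) ^ k := by
        rw [Real.div_rpow hr.le (by positivity), div_eq_mul_inv]
        gcongr
        rw [← Real.rpow_natCast, ← Real.rpow_natCast, ← Real.rpow_mul hN0.le,
          ← Real.rpow_mul hN0.le, ← Real.rpow_neg hN0.le]
        refine Real.rpow_le_rpow_of_exponent_le hN1.le ?_
        have h2 : (0 : ℝ) ≤ k := Nat.cast_nonneg k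
        have h3 : α ≤ 2 * s := by linarith [hNα.le]
        nlinarith
      calc F * (r / N ^ k) ^ (2 * s) ≤ F * (r ^ (2 * s) * (N ^ (-α)) ^ k) := by gcongr
        _ = F * r ^ (2 * s) * (N ^ (-α)) ^ k := by ring
        _ ≤ (a * kernelMass d s lam N * decayFactor d s lam Lam / 16) * (N ^ (-α)) ^ k := by gcongr
        _ = _ := by ring

/-! ### From oscillation decay to the Hölder estimate -/

lemma rpow_abs_sub_le_parabolicDist {s : ℝ} (hs : 0 < s) (p q : Space d × ℝ) :
    |p.2 - q.2| ≤ parabolicDist s p q ^ (2 * s) := by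
  have h1 : |p.2 - q.2| = (|p.2 - q.2| ^ (1 / (2 * s))) ^ (2 * s) := by
    rw [← Real.rpow_mul (abs_nonneg _), one_div_mul_cancel (by positivity), Real.rpow_one]
  rw [h1]
  exact Real.rpow_le_rpow (by positivity) (le_max_right _ _) (by positivity)

lemma parabolicDist_comm (s : ℝ) (p q : Space d × ℝ) : parabolicDist s p q = parabolicDist s q p := by
  unfold parabolicDist
  rw [dist_comm, abs_sub_comm]

/-- The cylinders look backward in time, so their vertex is the later point `p`. -/
theorem abs_sub_le_of_le {s lam Lam ρ R F N a α κ₀ : ℝ} {K : Space d → Space d → ℝ → ℝ}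
    {f u : Space d → ℝ → ℝ} (hd : 1 ≤ d) (hs : s ∈ Ioo (0 : ℝ) 1)
    (hlam : 0 < lam) (hLam : 0 ≤ Lam) (hρ : 0 < ρ) (hR : 0 < R)
    (hK : IsAdmissibleKernel s lam Lam ρ R K)
    (hu : IsViscositySolution (linearOperator s K) f (ball 0 R) (timeInterval s R) u)
    (hf : ∀ x ∈ ball (0 : Space d) R, ∀ t ∈ timeInterval s R, |f x t| ≤ F)
    (hNα : IsDecayPair d s lam Lam N α) (hκ₀ : 0 < κ₀) (hκN : N * κ₀ ≤ 1 / 2)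
    (hκs : 2 * κ₀ ^ (2 * s) + (1 / 2) ^ (2 * s) ≤ 1)
    (ha : 0 < a) (hF0 : 0 ≤ F)
    (hF : F * R ^ (2 * s) ≤ a * kernelMass d s lam N * decayFactor d s lam Lam / 16)
    (hua : ∀ x, ∀ t ∈ timeInterval s R, |u x t| ≤ a) {p q : Space d × ℝ}
    (hp : p ∈ ball (0 : Space d) (R / 2) ×ˢ timeInterval s (R / 2))
    (hq : q ∈ ball (0 : Space d) (R / 2) ×ˢ timeInterval s (R / 2))
    (hpq : ρ < parabolicDist s p q) (hle : q.2 ≤ p.2) :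
    |u p.1 p.2 - u q.1 q.2| ≤ 2 * a * (N / κ₀ * (parabolicDist s p q / R)) ^ α := by
  have hN1 := hNα.one_lt
  have hN0 : 0 < N := zero_lt_one.trans hN1
  have hs0 := hs.1
  have hα := hNα.pos
  set D := parabolicDist s p q with hD
  have hD0 : 0 < D := hρ.trans hpq
  set r := κ₀ * R with hr
  have hr0 : 0 < r := mul_pos hκ₀ hR
  have hNr : N * r ≤ R / 2 := by rw [hr, ← mul_assoc]; nlinarith
  have harg : N / κ₀ * (D / R) = N * D / r := by rw [hr]; field_simp
  rw [harg]
  have hRhalf : (R / 2) ^ (2 * s) = R ^ (2 * s) * (1 / 2) ^ (2 * s) := by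
    rw [← Real.mul_rpow hR.le (by norm_num)]; congr 1; ring
  have hRs : 0 < R ^ (2 * s) := by positivity
  have hsub : timeInterval s (R / 2) ⊆ timeInterval s R := by
    refine Ioc_subset_Ioc_left (neg_le_neg ?_)
    gcongr
    linarith
  have hpt : -(R / 2) ^ (2 * s) < p.2 ∧ p.2 ≤ 0 := hp.2
  have hI : Icc (p.2 - 2 * r ^ (2 * s)) p.2 ⊆ timeInterval s R := by
    intro t ht
    refine ⟨?_, ht.2.trans hpt.2⟩
    have h1 : r ^ (2 * s) = κ₀ ^ (2 * s) * R ^ (2 * s) := Real.mul_rpow hκ₀.le hR.le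
    have h2 := ht.1
    rw [hRhalf] at hpt
    have h3 := mul_le_mul_of_nonneg_right hκs hRs.le
    linarith [hpt.1]
  have hball : closedBall p.1 (N * r) ⊆ ball 0 R := by
    refine closedBall_subset_ball' ?_
    have := mem_ball.1 hp.1
    linarith
  -- With `l = -a`, the global bound `|u| ≤ a` gives the tail condition for free.
  have hinit : HasOscillationBound s N α u p.1 p.2 r a := by
    refine ⟨-a, fun t ht x _ => ?_, fun t ht x hx => ?_⟩
    · have := abs_le.1 (hua x t (hI ht))
      constructor <;> linarith
    · have h1 := abs_le.1 (hua x t (hI ht))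
      have h2 : 1 ≤ (‖x - p.1‖ / r) ^ α := by
        refine Real.one_le_rpow ((one_le_div hr0).2 (le_trans ?_ hx)) hα.le
        exact le_mul_of_one_le_left hr0.le hN1.le
      have h3 : 0 ≤ 2 * a * ((‖x - p.1‖ / r) ^ α - 1) :=
        mul_nonneg (by positivity) (by linarith)
      constructor <;> linarith
  have hFr : F * r ^ (2 * s) ≤ a * kernelMass d s lam N * decayFactor d s lam Lam / 16 := by
    refine le_trans ?_ hF
    gcongr
    nlinarith
  rcases lt_or_ge D r with hlt | hge
  -- The last scale `r / N ^ k` not below `D`. It exceeds `ρ` because `D` does, and `r / N ^ (k + 1)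
  -- < D` turns the decay into a power of `D`.
  · obtain ⟨k, hk1, hk2⟩ := exists_nat_pow_near ((one_le_div hD0).2 hlt.le) hN1
    have hNk : 0 < N ^ k := by positivity
    have hDk : D ≤ r / N ^ k := by
      rw [le_div_iff₀ hD0] at hk1
      rw [le_div_iff₀ hNk]; linarith
    obtain ⟨l, hosc, -⟩ := hinit.iterate hd hs hlam hLam hρ hK hu hf hNα hr0 hball hI ha hF0 hFr k
      (hpq.le.trans hDk)
    have hrk : 0 < r / N ^ k := by positivity
    have hrk2 : 0 < (r / N ^ k) ^ (2 * s) := by positivity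
    have hbig : r / N ^ k < N * (r / N ^ k) := lt_mul_of_one_lt_left hrk hN1
    have h1 := hosc p.2 ⟨by linarith, le_rfl⟩ p.1 (mem_ball_self (by positivity))
    have h2 := hosc q.2 ⟨by
        have h3 := rpow_abs_sub_le_parabolicDist hs0 p q
        have h4 : D ^ (2 * s) ≤ (r / N ^ k) ^ (2 * s) := by gcongr
        have h5 := le_abs_self (p.2 - q.2)
        linarith, hle⟩ q.1 (by
        rw [mem_ball, dist_comm]
        exact ((le_max_left _ _).trans hDk).trans_lt hbig)
    have h3 : |u p.1 p.2 - u q.1 q.2| ≤ 2 * (a * (N ^ (-α)) ^ k) := by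
      rw [abs_le]
      constructor <;> linarith
    have h4 : (N ^ (-α)) ^ k ≤ (N * D / r) ^ α := by
      have h5 : (N ^ (-α)) ^ k = ((N ^ k)⁻¹) ^ α := by
        rw [← Real.rpow_natCast, ← Real.rpow_natCast, ← Real.rpow_neg hN0.le,
          ← Real.rpow_mul hN0.le, ← Real.rpow_mul hN0.le]
        congr 1; ring
      rw [h5]
      refine Real.rpow_le_rpow (by positivity) ?_ hα.le
      rw [inv_le_iff_one_le_mul₀ hNk, div_mul_eq_mul_div, one_le_div hr0]
      rw [div_lt_iff₀ hD0, pow_succ] at hk2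
      linarith
    calc _ ≤ _ := h3
      _ ≤ 2 * (a * (N * D / r) ^ α) := by gcongr
      _ = _ := by ring
  · have h1 := abs_le.1 (hua p.1 p.2 (hsub hp.2))
    have h2 := abs_le.1 (hua q.1 q.2 (hsub hq.2))
    have h3 : 1 ≤ (N * D / r) ^ α :=
      Real.one_le_rpow ((one_le_div hr0).2 (by nlinarith)) hα.le
    have h4 : |u p.1 p.2 - u q.1 q.2| ≤ 2 * a := by
      rw [abs_le]
      constructor <;> linarith
    exact h4.trans (le_mul_of_one_le_right (by positivity) h3)

/-- Boundedness is essential: `sSup` of an unbounded set is `0`. -/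
lemma abs_le_supNormOn {g : Space d → ℝ → ℝ} {S : Set (Space d × ℝ)} {M : ℝ}
    (hM : ∀ p ∈ S, |g p.1 p.2| ≤ M) {p : Space d × ℝ} (hp : p ∈ S) :
    |g p.1 p.2| ≤ supNormOn g S :=
  le_csSup ⟨M, forall_mem_image.2 hM⟩ (mem_image_of_mem _ hp)

lemma supNormOn_nonneg (g : Space d → ℝ → ℝ) (S : Set (Space d × ℝ)) : 0 ≤ supNormOn g S :=
  Real.sSup_nonneg (forall_mem_image.2 fun _ _ => abs_nonneg _)

/-- Room for a cylinder of radius `N κ₀ R` and duration `2 (κ₀ R) ^ (2s)` at any vertex in the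
half-size cylinder; in time this uses `(1/2) ^ (2s) < 1`. -/
lemma exists_initial_scale {s N : ℝ} (hs : 0 < s) (hN : 0 < N) :
    ∃ κ₀ > (0 : ℝ), N * κ₀ ≤ 1 / 2 ∧ 2 * κ₀ ^ (2 * s) + (1 / 2) ^ (2 * s) ≤ 1 := by
  have hgap : (1 / 2 : ℝ) ^ (2 * s) < 1 :=
    Real.rpow_lt_one (by norm_num) (by norm_num) (by positivity)
  have hlim : Tendsto (fun x : ℝ => 2 * x ^ (2 * s) + (1 / 2) ^ (2 * s)) (𝓝[>] 0)
      (𝓝 (2 * 0 ^ (2 * s) + (1 / 2) ^ (2 * s))) :=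
    (((Real.continuousAt_rpow_const 0 (2 * s) (Or.inr (by positivity))).const_mul
      2).add_const _).tendsto.mono_left nhdsWithin_le_nhds
  rw [Real.zero_rpow (by positivity), mul_zero, zero_add] at hlim
  obtain ⟨x, ⟨hx1, hx2⟩, hx3⟩ := ((hlim.eventually_le_const hgap).and
    (Ioc_mem_nhdsGT (show (0 : ℝ) < 1 / (2 * N) by positivity))).exists.imp
      fun x hx => (⟨⟨hx.1, hx.2.1⟩, hx.2.2⟩ : (_ ∧ _) ∧ _)
  refine ⟨x, hx2, ?_, hx1⟩
  rw [le_div_iff₀ (by positivity)] at hx3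
  linarith

end

end NonlocalParabolic

theorem mainTheorem5 (d : ℕ) (hd : 1 ≤ d) (s : ℝ) (hs : s ∈ Set.Ioo (0 : ℝ) 1)
    (lam Lam : ℝ) (hlam : 0 < lam) (hLam : lam < Lam) :
    ∃ α ∈ Set.Ioo (0 : ℝ) (2 * s), ∃ C > (0 : ℝ),
      ∀ (ρ R : ℝ), 0 < ρ → ρ < R →
      ∀ K : NonlocalParabolic.Space d → NonlocalParabolic.Space d → ℝ → ℝ,
      NonlocalParabolic.IsAdmissibleKernel s lam Lam ρ R K →
      ∀ f : NonlocalParabolic.Space d → ℝ → ℝ,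
      (∃ A : ℝ, ∀ x ∈ Metric.ball (0 : NonlocalParabolic.Space d) R,
        ∀ t ∈ NonlocalParabolic.timeInterval s R, |f x t| ≤ A) →
      ∀ u : NonlocalParabolic.Space d → ℝ → ℝ,
      NonlocalParabolic.IsViscositySolution (NonlocalParabolic.linearOperator s K) f
        (Metric.ball 0 R) (NonlocalParabolic.timeInterval s R) u →
      ∀ p ∈ Metric.ball (0 : NonlocalParabolic.Space d) (R / 2) ×ˢ
          NonlocalParabolic.timeInterval s (R / 2),
      ∀ q ∈ Metric.ball (0 : NonlocalParabolic.Space d) (R / 2) ×ˢ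
          NonlocalParabolic.timeInterval s (R / 2),
      ρ < NonlocalParabolic.parabolicDist s p q →
      |u p.1 p.2 - u q.1 q.2| / NonlocalParabolic.parabolicDist s p q ^ α ≤
        C / R ^ α *
          (NonlocalParabolic.supNormOn u (Set.univ ×ˢ NonlocalParabolic.timeInterval s R) +
            R ^ (2 * s) * NonlocalParabolic.supNormOn f
              (Metric.ball 0 R ×ˢ NonlocalParabolic.timeInterval s R)) := by
  have hs0 := hs.1
  obtain ⟨N, α, hNα⟩ := NonlocalParabolic.exists_isDecayPair d Lam hs hlam
  have hN0 : 0 < N := zero_lt_one.trans hNα.one_lt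
  have hα := hNα.pos
  obtain ⟨κ₀, hκ₀, hκN, hκs⟩ := NonlocalParabolic.exists_initial_scale hs0 hN0
  set Θ := NonlocalParabolic.kernelMass d s lam N *
    NonlocalParabolic.decayFactor d s lam Lam / 16 with hΘ
  have hΘ0 : 0 < Θ := by
    have := NonlocalParabolic.kernelMass_pos (d := d) (s := s) hlam hN0
    have : 0 < NonlocalParabolic.decayFactor d s lam Lam := Real.exp_pos _
    positivity
  refine ⟨α, ⟨hα, by linarith [hNα.le]⟩, 2 * (1 + Θ⁻¹) * (N / κ₀) ^ α, by positivity, ?_⟩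
  intro ρ R hρ hρR K hK f ⟨A, hA⟩ u hu p hp q hq hpq
  have hR : 0 < R := hρ.trans hρR
  set U := NonlocalParabolic.supNormOn u (Set.univ ×ˢ NonlocalParabolic.timeInterval s R)
  set F := NonlocalParabolic.supNormOn f (Metric.ball 0 R ×ˢ NonlocalParabolic.timeInterval s R)
  have hU0 : 0 ≤ U := NonlocalParabolic.supNormOn_nonneg _ _
  have hF0 : 0 ≤ F := NonlocalParabolic.supNormOn_nonneg _ _
  obtain ⟨M, hM⟩ := hu.1.bounded.1
  have hUb : ∀ x, ∀ t ∈ NonlocalParabolic.timeInterval s R, |u x t| ≤ U := fun x t ht =>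
    NonlocalParabolic.abs_le_supNormOn (p := (x, t)) (fun p hp => hM p.1 p.2 hp.2)
      ⟨Set.mem_univ _, ht⟩
  have hFb : ∀ x ∈ Metric.ball (0 : NonlocalParabolic.Space d) R,
      ∀ t ∈ NonlocalParabolic.timeInterval s R, |f x t| ≤ F := fun x hx t ht =>
    NonlocalParabolic.abs_le_supNormOn (p := (x, t)) (fun p hp => hA p.1 hp.1 p.2 hp.2) ⟨hx, ht⟩
  set D := NonlocalParabolic.parabolicDist s p q with hD
  have hD0 : 0 < D := hρ.trans hpq
  have hRs : 0 < R ^ (2 * s) := by positivity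
  have hS0 : 0 ≤ U + R ^ (2 * s) * F := by positivity
  -- Such an `a` bounds `|u|` and also meets the smallness condition `F R ^ (2s) ≤ Θ a`.
  have key : ∀ a, (1 + Θ⁻¹) * (U + R ^ (2 * s) * F) ≤ a → 0 < a →
      |u p.1 p.2 - u q.1 q.2| ≤ 2 * a * (N / κ₀ * (D / R)) ^ α := by
    intro a ha ha0
    have h1 : 0 ≤ Θ⁻¹ * U := by positivity
    have h2 : 0 ≤ Θ⁻¹ * (R ^ (2 * s) * F) := by positivity
    have h3 : 0 ≤ R ^ (2 * s) * F := by positivity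
    have hua : ∀ x, ∀ t ∈ NonlocalParabolic.timeInterval s R, |u x t| ≤ a := fun x t ht =>
      (hUb x t ht).trans (by linarith)
    have hFa : F * R ^ (2 * s) ≤ a * NonlocalParabolic.kernelMass d s lam N *
        NonlocalParabolic.decayFactor d s lam Lam / 16 := by
      have h4 : Θ⁻¹ * (R ^ (2 * s) * F) ≤ a := by linarith
      have h5 := mul_le_mul_of_nonneg_left h4 hΘ0.le
      rw [mul_inv_cancel_left₀ hΘ0.ne'] at h5
      rw [hΘ] at h5
      linarith
    rcases le_total q.2 p.2 with h | h
    · exact NonlocalParabolic.abs_sub_le_of_le hd hs hlam (hlam.trans hLam).le hρ hR hK hu hFb hNα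
        hκ₀ hκN hκs ha0 hF0 hFa hua hp hq hpq h
    · rw [abs_sub_comm, hD, NonlocalParabolic.parabolicDist_comm]
      exact NonlocalParabolic.abs_sub_le_of_le hd hs hlam (hlam.trans hLam).le hρ hR hK hu hFb hNα
        hκ₀ hκN hκs ha0 hF0 hFa hua hq hp (by rwa [NonlocalParabolic.parabolicDist_comm]) h
  have hfin : |u p.1 p.2 - u q.1 q.2| ≤
      2 * ((1 + Θ⁻¹) * (U + R ^ (2 * s) * F)) * (N / κ₀ * (D / R)) ^ α := by
    have hpow : 0 < (N / κ₀ * (D / R)) ^ α := by positivity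
    -- The iteration needs `a > 0`, while both norms may vanish; hence the limit from above.
    refine le_of_forall_pos_le_add fun ε hε => ?_
    have hx : 0 < ε / (2 * (N / κ₀ * (D / R)) ^ α) := by positivity
    have h := key ((1 + Θ⁻¹) * (U + R ^ (2 * s) * F) + ε / (2 * (N / κ₀ * (D / R)) ^ α))
      (by linarith) (by positivity)
    refine h.trans (le_of_eq ?_)
    field_simp
  rw [div_le_iff₀ (by positivity)]
  refine hfin.trans (le_of_eq ?_)
  rw [Real.mul_rpow (by positivity) (by positivity), Real.div_rpow hD0.le hR.le]
  ring
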